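/- Fix $d>1$. A labelled degree-$d$ graph $G$ consists of a finite vertex set $V$ and a map $\rho:V\times\{1,\dots,d\}\to V$ (the edge labelled $i$ leads from $v$ to $\rho(v,i)$), together with distinguished nodes startnode and targetnode in $V$. A node is reachable if it is the end of a directed path from startnode. A nondeterministic jumping automaton for graphs (nd-jag) has a finite set of states with a start state $q_0$ and an accept state $q_a$, a finite set $P$ of pebbles with two distinct dedicated pebbles $s,t\in P$, and a transition function assigning to each state and each equivalence relation on $P$ a set of pairs (successor state, one move for each pebble); a move is either "move along edge $i$" ($1\le i\le d$) or "jump to the old position of pebble $j$" ($j\in P$). Initially the state is $q_0$, pebble $t$ is on targetnode and all other pebbles are on startnode. In each step the automaton sees its state and which pebbles share a node, chooses one of the allowed pairs, and carries out all pebble moves simultaneously. A computation is accepting if it is finite, begins in the initial configuration and ends in state $q_a$; the automaton accepts $G$ if it has an accepting computation on $G$, and rejects $G$ otherwise. A family $F$ of labelled degree-$d$ graphs is traversable if there are an nd-jag $J$ and a pebble $\mathit{curr}$ of $J$ such that, for each $G\in F$, $J$ accepts $G$ and in every accepting computation of $J$ on $G$ the nodes on which $\mathit{curr}$ is placed are exactly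 the nodes reachable from startnode. The family is orderable if $J$ and $\mathit{curr}$ can be chosen such that, in addition, for each $G\in F$ the sequence of nodes on which $\mathit{curr}$ is placed (immediate repetitions being ignored) is the same for all accepting computations of $J$ on $G$. A property of finite labelled degree-$d$ graphs with a start node and an optional marked target node is in NLOGSPACE if it is decided, on the adjacency-matrix encodings of such graphs along arbitrary numberings of the vertices, by a language accepted by a nondeterministic Turing machine with a read-only input tape and a work tape of which it uses $O(\log N)$ cells in all computations on inputs of length $N$. **Theorem.** Let $F$ be a family of labelled degree-$d$ graphs. 1. If $F$ is traversable, then nd-jags solve co-$st$-connectivity on $F$: there is an nd-jag $J'$ such that for all $G\in F$, $J'$ accepts $G$ if and only if targetnode is not reachable from startnode in $G$. 2. If $F$ is orderable, then nd-jags decide every NLOGSPACE property of the subgraph reachable from startnode: for every NLOGSPACE property $R$ there is an nd-jag $J'$ such that for all $G\in F$, $J'$ accepts $G$ if and only if the subgraph of $G$ induced on the nodes reachable from startnode, with startnode marked, and with targetnode marked if it is reachable, has property $R$. -/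

import Mathlib

universe u

/-! ### Labelled graphs of degree `d` -/

/-- A finite labelled degree `d` graph: every vertex `v` has exactly one outgoing edge for each
label `i`, leading to `next v i`; there are two distinguished vertices (possibly equal). -/
structure LGraph (d : ℕ) : Type (u + 1) where
  V : Type u
  finite : Finite V
  next : V → Fin d → V
  startnode : V
  targetnode : V

namespace LGraph

variable {d : ℕ}

/-- The endpoint `v.w` of the path with label sequence `w` that begins in `v`. -/
def walk (G : LGraph.{u} d) (v : G.V) (w : List (Fin d)) : G.V :=
  w.foldl G.next v

/-- `v` is reachable from the start node. -/
def Reachable (G : LGraph.{u} d) (v : G.V) : Prop :=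
  ∃ w : List (Fin d), G.walk G.startnode w = v

theorem reachable_startnode (G : LGraph.{u} d) : G.Reachable G.startnode :=
  ⟨[], rfl⟩

theorem Reachable.next {G : LGraph.{u} d} {v : G.V} (h : G.Reachable v) (i : Fin d) :
    G.Reachable (G.next v i) := by
  obtain ⟨w, rfl⟩ := h
  exact ⟨w ++ [i], by simp [walk]⟩

end LGraph

/-! ### Nondeterministic jumping automata for graphs -/

/-- A move of one pebble: along the edge labelled `i`, or to the (old) position of pebble `j`. -/
inductive PebbleMove (d : ℕ) (P : Type) : Type where
  | move (i : Fin d) : PebbleMove d P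
  | jump (j : P) : PebbleMove d P

/-- A nondeterministic jumping automaton for graphs of degree `d`, with a finite set `Q` of states
and a finite set `P` of pebbles. The transition function sees the state and the incidence relation
of the pebbles, and returns a set of pairs (successor state, one move for each pebble). -/
structure NDJag (d : ℕ) : Type 1 where
  Q : Type
  P : Type
  finiteQ : Finite Q
  finiteP : Finite P
  q₀ : Q
  qa : Q
  s : P
  t : P
  s_ne_t : s ≠ t
  δ : Q → Setoid P → Set (Q × (P → PebbleMove d P))

namespace NDJag

variable {d : ℕ}

/-- An instantaneous description of `J` on `G`. -/
@[ext] structure ID (J : NDJag d) (G : LGraph.{u} d) : Type u where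
  state : J.Q
  node : J.P → G.V

/-- The initial description: pebble `t` is on the target node, all others on the start node. -/
noncomputable def initial (J : NDJag d) (G : LGraph.{u} d) : J.ID G := by
  classical
  exact ⟨J.q₀, fun p => if p = J.t then G.targetnode else G.startnode⟩

/-- The effect of a vector of simultaneous pebble moves. -/
def moveAll (J : NDJag d) (G : LGraph.{u} d) (node : J.P → G.V) (c : J.P → PebbleMove d J.P) :
    J.P → G.V :=
  fun p => match c p with
    | .move i => G.next (node p) i
    | .jump j => node j

/-- One legal move; `Setoid.ker x.node` relates two pebbles iff they are on the same node. -/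
def Step (J : NDJag d) (G : LGraph.{u} d) (x y : J.ID G) : Prop :=
  ∃ c : J.P → PebbleMove d J.P,
    (y.state, c) ∈ J.δ x.state (Setoid.ker x.node) ∧ y.node = J.moveAll G x.node c

/-- `l` is a finite computation that begins in the initial description and ends in `qa`. -/
def IsAcceptingComputation (J : NDJag d) (G : LGraph.{u} d) (l : List (J.ID G)) : Prop :=
  l.head? = some (J.initial G) ∧ l.IsChain (J.Step G) ∧ ∃ x ∈ l.getLast?, x.state = J.qa

def Accepts (J : NDJag d) (G : LGraph.{u} d) : Prop :=
  ∃ l : List (J.ID G), J.IsAcceptingComputation G l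

/-- The sequence of nodes on which pebble `curr` is placed along a computation. Steps during which
`curr` rests where it is do not count as new placements. -/
noncomputable def placements (J : NDJag d) (G : LGraph.{u} d) (curr : J.P) (l : List (J.ID G)) :
    List G.V := by
  classical
  exact (l.map fun x => x.node curr).destutter (· ≠ ·)

/-- `J` accepts `G`, and in every accepting computation the nodes visited by `curr` are exactly the
nodes reachable from the start node. -/
def Traverses (J : NDJag d) (curr : J.P) (G : LGraph.{u} d) : Prop :=
  J.Accepts G ∧ ∀ l, J.IsAcceptingComputation G l →
    ∀ v : G.V, (∃ x ∈ l, x.node curr = v) ↔ G.Reachable v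

/-- `J` traverses `G`, and all accepting computations place `curr` on the same sequence of nodes. -/
def Orders (J : NDJag d) (curr : J.P) (G : LGraph.{u} d) : Prop :=
  J.Traverses curr G ∧ ∀ l l', J.IsAcceptingComputation G l → J.IsAcceptingComputation G l' →
    J.placements G curr l = J.placements G curr l'

end NDJag

/-- A family of graphs is traversable if one automaton traverses all of its members. -/
def TraversableFamily {d : ℕ} (F : Set (LGraph.{u} d)) : Prop :=
  ∃ (J : NDJag d) (curr : J.P), ∀ G ∈ F, J.Traverses curr G

/-- A family of graphs is orderable if one automaton orders all of its members. -/
def OrderableFamily {d : ℕ} (F : Set (LGraph.{u} d)) : Prop :=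
  ∃ (J : NDJag d) (curr : J.P), ∀ G ∈ F, J.Orders curr G

/-! ### Nondeterministic logarithmic space -/

/-- What the input head reads: an end marker or an input bit. -/
inductive InputSym : Type where
  | leftEnd : InputSym
  | rightEnd : InputSym
  | bit (b : Bool) : InputSym

/-- Head movements. -/
inductive Shift : Type where
  | left : Shift
  | stay : Shift
  | right : Shift

/-- The new head position; a head on cell `0` cannot move further to the left. -/
def Shift.apply : Shift → ℕ → ℕ
  | .left, p => p - 1
  | .stay, p => p
  | .right, p => p + 1

/-- A nondeterministic Turing machine with a two-way read-only input tape and a one-way infinite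
work tape. -/
structure OfflineNTM : Type 1 where
  K : Type
  Γ : Type
  finiteK : Finite K
  finiteΓ : Finite Γ
  blank : Γ
  k₀ : K
  ka : K
  δ : K → InputSym → Γ → Set (K × Γ × Shift × Shift)

namespace OfflineNTM

structure Cfg (M : OfflineNTM) : Type where
  state : M.K
  inPos : ℕ
  workPos : ℕ
  work : ℕ → M.Γ

/-- The input tape holds the left marker in cell `0`, the word `w` in cells `1, …, w.length`, and
the right marker in cell `w.length + 1`. -/
def readInput (w : List Bool) : ℕ → InputSym
  | 0 => .leftEnd
  | p + 1 => match w[p]? with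
    | some b => .bit b
    | none => .rightEnd

def initial (M : OfflineNTM) : M.Cfg :=
  ⟨M.k₀, 0, 0, fun _ => M.blank⟩

/-- One step on input `w`: read, write the symbol `a`, shift both heads. The input head does not
leave the end markers. -/
def Step (M : OfflineNTM) (w : List Bool) (x y : M.Cfg) : Prop :=
  ∃ (k : M.K) (a : M.Γ) (m m' : Shift),
    (k, a, m, m') ∈ M.δ x.state (readInput w x.inPos) (x.work x.workPos) ∧
    y = ⟨k, min (m.apply x.inPos) (w.length + 1), m'.apply x.workPos,
      Function.update x.work x.workPos a⟩

/-- `x` occurs in some computation of `M` on `w`. -/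
def ReachableCfg (M : OfflineNTM) (w : List Bool) (x : M.Cfg) : Prop :=
  Relation.ReflTransGen (M.Step w) M.initial x

def Accepts (M : OfflineNTM) (w : List Bool) : Prop :=
  ∃ x, M.ReachableCfg w x ∧ x.state = M.ka

/-- In all computations the work head stays within the first `O(log |w|)` cells. -/
def IsLogspace (M : OfflineNTM) : Prop :=
  ∃ c : ℕ, ∀ (w : List Bool) (x : M.Cfg), M.ReachableCfg w x →
    x.workPos ≤ c * (Nat.log 2 w.length + 1)

end OfflineNTM

/-- The complexity class of the languages decided in nondeterministic logarithmic space. -/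
def InNLogspace (L : Set (List Bool)) : Prop :=
  ∃ M : OfflineNTM, M.IsLogspace ∧ ∀ w, M.Accepts w ↔ w ∈ L

/-! ### Properties of the part of a graph that is reachable from the start node -/

/-- A finite labelled degree `d` graph with a start node, in which a target node may be marked. -/
structure SGraph (d : ℕ) : Type (u + 1) where
  V : Type u
  finite : Finite V
  next : V → Fin d → V
  startnode : V
  targetnode : Option V

open Classical in
/-- The subgraph of `G` reachable from the start node. It inherits the start node, and the target
node if that is reachable. -/
noncomputable def LGraph.reachablePart {d : ℕ} (G : LGraph.{u} d) : SGraph.{u} d where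
  V := {v : G.V // G.Reachable v}
  finite := by
    have := G.finite
    infer_instance
  next v i := ⟨G.next v.1 i, v.2.next i⟩
  startnode := ⟨G.startnode, G.reachable_startnode⟩
  targetnode := if h : G.Reachable G.targetnode then some ⟨G.targetnode, h⟩ else none

/-- The encoding of a graph as a bit string along a numbering `e` of its vertices: the
characteristic vectors of the start node and of the target node (all zero if there is none),
followed, for each vertex `u` and each label `i`, by the characteristic vector of the end of the
edge labelled `i` from `u` (adjacency matrices). -/
def SGraph.encode {d : ℕ} (H : SGraph.{u} d) {n : ℕ} (e : H.V ≃ Fin n) : List Bool :=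
  ((List.finRange n).map fun v => decide (e H.startnode = v)) ++
  ((List.finRange n).map fun v => decide (H.targetnode.map e = some v)) ++
  (List.finRange n).flatMap fun u => (List.finRange d).flatMap fun i =>
    (List.finRange n).map fun v => decide (e (H.next (e.symm u) i) = v)

/-- A graph property is in NLOGSPACE if some language in NLOGSPACE decides it from the encodings of
graphs, whatever the numbering of the vertices. In particular it is isomorphism invariant. -/
def IsNLogspaceProperty {d : ℕ} (R : SGraph.{u} d → Prop) : Prop :=
  ∃ L : Set (List Bool), InNLogspace L ∧
    ∀ (H : SGraph.{u} d) (n : ℕ) (e : H.V ≃ Fin n), H.encode e ∈ L ↔ R H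

/-! ### Recognizable predicates of pebble placements -/

open Relation

/-! Automata are treated as a positive logic. A predicate of pebble placements is recognizable
(`Recog`) if one automaton, started from the placement, can reach its accept state exactly when the
predicate holds, for all graphs in `F` and wherever its scratch pebbles lie. By `Recog.guarded`, a
nondeterministic program whose tests are recognizable is itself recognizable. This gives
conjunction, disjunction and tests after a move. It also gives iteration of a step on tuples of
reachable nodes (`Recog.tc`), since a reachable node can be guessed by walking to it from the start
node. Negation is not available in general.

A traversing automaton `J` supplies the missing universal quantifier. `J` is simulated and `φ` is
tested at each node under `curr`. `J` has an accepting computation, and each one visits exactly the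
reachable nodes, so some supervised computation succeeds if and only if `φ` holds at all reachable
nodes (`Recog.forall_reachable`). Part 1 is the case where `φ` says that the node is not the target.

If `J` orders the graphs, the order of first visits does not depend on the computation, and a
two-state supervisor decides it (`OrderableFamily.exists_idx`). Ties are equalities of nodes, so the
weak order is also recognizable on reachable nodes. With the universal quantifier this makes
"first", "last" and "successor" recognizable, hence a numbering of the `n` reachable nodes by `0, …,
n - 1` (`OrderableFamily.exists_rank`).

Numbers below `K * n ^ k` are then written as `k` digits in base `n`, each held by a pebble, and a
leading digit below `K`, held in the state (`NumRecog`). Successor is defined by carrying, addition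
and multiplication by iteration, and so the bits of the encoding of the reachable part along this
numbering can be read (`NumRecog.read`). A configuration of a logspace machine is four numbers: two
head positions and the two halves of the work tape. They are polynomially bounded by `pow_log_le`,
one step is an arithmetic predicate, and iterating it decides acceptance (`NumRecog.accepts`). As
the property does not depend on the numbering, part 2 follows. -/

instance PebbleMove.instFinite {d : ℕ} {P : Type} [Finite P] : Finite (PebbleMove d P) :=
  Finite.of_surjective (fun x : Fin d ⊕ P => x.elim PebbleMove.move PebbleMove.jump) fun c => by
    cases c with
    | move i => exact ⟨.inl i, rfl⟩
    | jump j => exact ⟨.inr j, rfl⟩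

/-- Renaming of pebbles in a move. -/
def PebbleMove.map {d : ℕ} {P P' : Type} (f : P → P') : PebbleMove d P → PebbleMove d P'
  | .move i => .move i
  | .jump j => .jump (f j)

namespace LGraph

variable {d : ℕ}

/-- The effect of a vector of simultaneous pebble moves on a placement `x`. -/
def shift (G : LGraph.{u} d) {A : Type} (c : A → PebbleMove d A) (x : A → G.V) : A → G.V :=
  fun p => match c p with
    | .move i => G.next (x p) i
    | .jump j => x j

/-- One step of an automaton with transition function `δ`. -/
def Trans (G : LGraph.{u} d) {Q A : Type} (δ : Q → Setoid A → Set (Q × (A → PebbleMove d A)))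
    (x y : Q × (A → G.V)) : Prop :=
  ∃ c, (y.1, c) ∈ δ x.1 (Setoid.ker x.2) ∧ y.2 = G.shift c x.2

/-- The placement `ν` together with pebbles on the start node (`false`) and on the target node
(`true`). -/
def val (G : LGraph.{u} d) {P : Type} (ν : P → G.V) : P ⊕ Bool → G.V :=
  Sum.elim ν fun b => bif b then G.targetnode else G.startnode

@[simp] theorem val_inl (G : LGraph.{u} d) {P : Type} (ν : P → G.V) (p : P) :
    G.val ν (.inl p) = ν p := rfl

@[simp] theorem val_false (G : LGraph.{u} d) {P : Type} (ν : P → G.V) :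
    G.val ν (.inr false) = G.startnode := rfl

@[simp] theorem val_true (G : LGraph.{u} d) {P : Type} (ν : P → G.V) :
    G.val ν (.inr true) = G.targetnode := rfl

/-- `f` embeds the pebbles of a subroutine into a larger set. Jumps are renamed along `f`, so they
stay inside its range. -/
theorem shift_extend (G : LGraph.{u} d) {A A' : Type} {f : A → A'} (hf : f.Injective)
    (c : A → PebbleMove d A) (w : A' → G.V) :
    G.shift (Function.extend f (fun p => (c p).map f) fun z => .jump z) w ∘ f =
      G.shift c (w ∘ f) := by
  funext p
  simp only [shift, Function.comp, hf.extend_apply]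
  cases c p <;> rfl

theorem shift_extend_of_notMem (G : LGraph.{u} d) {A A' : Type} {f : A → A'}
    (c : A → PebbleMove d A) (w : A' → G.V) {z : A'} (hz : ¬ ∃ p, f p = z) :
    G.shift (Function.extend f (fun p => (c p).map f) fun z => .jump z) w z = w z := by
  simp only [shift, Function.extend_apply' _ _ _ hz]

end LGraph

/-- A finite automaton that starts with pebbles in a given placement of `P`, with pebbles on the
start node and on the target node, and with a finite set `B` of scratch pebbles. -/
structure Recognizer (d : ℕ) (P : Type) : Type 1 where
  Q : Type
  B : Type
  finiteQ : Finite Q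
  finiteB : Finite B
  q₀ : Q
  qa : Q
  δ : Q → Setoid ((P ⊕ Bool) ⊕ B) → Set (Q × ((P ⊕ Bool) ⊕ B → PebbleMove d ((P ⊕ Bool) ⊕ B)))

/-- `M` can reach its accept state from the placement `ν`, with its scratch pebbles on `b`. -/
def Recognizer.Accepts {d : ℕ} {P : Type} (M : Recognizer d P) (G : LGraph.{u} d) (ν : P → G.V)
    (b : M.B → G.V) : Prop :=
  ∃ y, ReflTransGen (G.Trans M.δ) (M.q₀, Sum.elim (G.val ν) b) (M.qa, y)

/-- Predicates of placements that are recognized by an automaton, uniformly for all graphs in `F`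
and irrespective of the initial placement of the scratch pebbles. -/
def Recog {d : ℕ} (F : Set (LGraph.{u} d)) (P : Type) (φ : ∀ G : LGraph.{u} d, (P → G.V) → Prop) :
    Prop :=
  ∃ M : Recognizer d P, ∀ G ∈ F, ∀ ν b, M.Accepts G ν b ↔ φ G ν

/-- One step of an automaton with guarded edges: an edge `e` leads from state `src e` to state
`dst e`, may be taken if `guard e` holds, and then moves the pebbles according to `mv e`. -/
def GuardedStep {d : ℕ} {A S E : Type} (src dst : E → S) (mv : E → A → PebbleMove d A)
    (guard : E → ∀ G : LGraph.{u} d, (A → G.V) → Prop) (G : LGraph.{u} d)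
    (a b : S × (A → G.V)) : Prop :=
  ∃ e, src e = a.1 ∧ dst e = b.1 ∧ guard e G a.2 ∧ b.2 = G.shift (mv e) a.2

namespace Recog

variable {d : ℕ} {F : Set (LGraph.{u} d)}

/-! ### Programs that call recognizers as subroutines -/

section guarded

variable {P A S E : Type} (g : A → P ⊕ Bool) (s₀ : S) (src dst : E → S)
  (mv : E → A → PebbleMove d A) (M : E → Recognizer d A)

/-- The pebbles of the automaton that runs the recognizers `M e` as subroutines. -/
abbrev GuardedPebble (P : Type) (M : E → Recognizer d A) : Type :=
  (P ⊕ Bool) ⊕ (A ⊕ Σ e, ((A ⊕ Bool) ⊕ (M e).B))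

/-- The copy of the pebbles of `M e`. -/
def guardCopy (e : E) (p : (A ⊕ Bool) ⊕ (M e).B) : GuardedPebble P M := .inr (.inr ⟨e, p⟩)

theorem guardCopy_injective (e : E) : (guardCopy (P := P) M e).Injective := fun p q h => by
  simpa [guardCopy] using h

/-- Places the local pebbles according to `g`. -/
def initMove : GuardedPebble P M → PebbleMove d (GuardedPebble P M) := fun z => .jump <|
  match z with
  | .inr (.inl a) => .inl (g a)
  | z => z

open Classical in
/-- Copies the local pebbles and the constants for the subroutine `M e`. -/
noncomputable def callMove (e : E) : GuardedPebble P M → PebbleMove d (GuardedPebble P M) :=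
  fun z => .jump <|
  match z with
  | .inr (.inr ⟨e', .inl (.inl a)⟩) => if e' = e then .inr (.inl a) else z
  | .inr (.inr ⟨e', .inl (.inr b)⟩) => if e' = e then .inl (.inr b) else z
  | z => z

/-- Moves the local pebbles. -/
def retMove (e : E) : GuardedPebble P M → PebbleMove d (GuardedPebble P M) :=
  fun z => match z with
  | .inr (.inl a) => (mv e a).map fun a => .inr (.inl a)
  | z => .jump z

/-- The states of the automaton that runs the recognizers `M e` as subroutines. -/
abbrev GuardedState (S : Type) (M : E → Recognizer d A) : Type := Option (S ⊕ Σ e, (M e).Q)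

/-- The transition function of the automaton that runs the recognizers `M e` for the guards. -/
noncomputable def guardedδ (q : GuardedState S M) (r : Setoid (GuardedPebble P M)) :
    Set (GuardedState S M × (GuardedPebble P M → PebbleMove d (GuardedPebble P M))) :=
  match q with
  | none => {(some (.inl s₀), initMove g M)}
  | some (.inl s) => {z | ∃ e, src e = s ∧ z = (some (.inr ⟨e, (M e).q₀⟩), callMove M e)}
  | some (.inr ⟨e, q⟩) =>
    {z | (∃ q' c, (q', c) ∈ (M e).δ q (r.comap (guardCopy M e)) ∧
        z = (some (.inr ⟨e, q'⟩),
          Function.extend (guardCopy M e) (fun p => (c p).map (guardCopy M e)) fun z => .jump z)) ∨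
      (q = (M e).qa ∧ z = (some (.inl (dst e)), retMove mv M e))}

theorem ker_comp {X Y Z : Type*} (f : X → Y) (w : Y → Z) :
    (Setoid.ker w).comap f = Setoid.ker (w ∘ f) := rfl

/-- After a call the copy looks like an initial placement of `M e`, except that its scratch pebbles
lie where earlier calls left them. This is why `Recog` demands independence of the scratch pebbles.
-/
theorem shift_callMove (e : E) (G : LGraph.{u} d) (w : GuardedPebble P M → G.V) (ν : P → G.V)
    (hw : w ∘ Sum.inl = G.val ν) :
    (G.shift (callMove M e) w) ∘ guardCopy M e =
      Sum.elim (G.val (w ∘ Sum.inr ∘ Sum.inl)) (w ∘ guardCopy M e ∘ Sum.inr) := by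
  funext p
  rcases p with (a | b) | b
  · simp [LGraph.shift, guardCopy, callMove]
  · have := congrFun hw (.inr b)
    simp only [Function.comp] at this
    simp [LGraph.shift, guardCopy, callMove, this]
    rfl
  · simp [LGraph.shift, guardCopy, callMove]

/-- Invariant: the constants never move. Between calls the local pebbles are at the end of a guarded
run; during a call they are frozen there, while the copies follow a run of `M e` from some scratch
placement. -/
theorem guarded_sound {guard : E → ∀ G : LGraph.{u} d, (A → G.V) → Prop}
    (hM : ∀ e, ∀ G ∈ F, ∀ ν b, (M e).Accepts G ν b ↔ guard e G ν) {G : LGraph.{u} d} (hG : G ∈ F)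
    (ν : P → G.V) (b : GuardedPebble P M → G.V) (hb : b ∘ Sum.inl = G.val ν)
    (s : S) (y : GuardedPebble P M → G.V)
    (hy : ReflTransGen (G.Trans (guardedδ g s₀ src dst mv M)) (none, b) (some (.inl s), y)) :
    ReflTransGen (GuardedStep src dst mv guard G) (s₀, G.val ν ∘ g) (s, y ∘ Sum.inr ∘ Sum.inl) := by
  let Inv : Option (S ⊕ Σ e, (M e).Q) × (GuardedPebble P M → G.V) → Prop := fun z =>
    z.2 ∘ Sum.inl = G.val ν ∧ match z.1 with
    | none => True
    | some (.inl s) => ReflTransGen (GuardedStep src dst mv guard G)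
        (s₀, G.val ν ∘ g) (s, z.2 ∘ Sum.inr ∘ Sum.inl)
    | some (.inr ⟨e, q⟩) => ReflTransGen (GuardedStep src dst mv guard G)
        (s₀, G.val ν ∘ g) (src e, z.2 ∘ Sum.inr ∘ Sum.inl) ∧
        ∃ b, ReflTransGen (G.Trans (M e).δ)
          ((M e).q₀, Sum.elim (G.val (z.2 ∘ Sum.inr ∘ Sum.inl)) b) (q, z.2 ∘ guardCopy M e)
  have key : ∀ z, ReflTransGen (G.Trans (guardedδ g s₀ src dst mv M))
      (none, b) z → Inv z := by
    intro z hz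
    induction hz with
    | refl => exact ⟨hb, trivial⟩
    | @tail z z' _ h ih =>
      obtain ⟨q, w⟩ := z
      obtain ⟨q', w'⟩ := z'
      obtain ⟨c, hc, hw⟩ := h
      obtain ⟨ih1, ih2⟩ := ih
      dsimp only at hc hw ih1 ih2
      subst hw
      match q, hc, ih2 with
      | none, hc, _ =>
        obtain ⟨rfl, rfl⟩ := Prod.mk.inj hc
        refine ⟨ih1, ?_⟩
        have : G.shift (initMove g M) w ∘ Sum.inr ∘ Sum.inl = G.val ν ∘ g := by
          rw [← ih1]; rfl
        dsimp only
        rw [this]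
      | some (.inl s), hc, ih2 =>
        obtain ⟨e, rfl, h⟩ := hc
        obtain ⟨rfl, rfl⟩ := Prod.mk.inj h
        refine ⟨ih1, ih2, w ∘ guardCopy M e ∘ Sum.inr, ?_⟩
        dsimp only
        rw [shift_callMove M e G w ν ih1]
        exact .refl
      | some (.inr ⟨e, q⟩), hc, ⟨ih2, b', ih3⟩ =>
        rcases hc with ⟨q₁, c₁, hc₁, h⟩ | ⟨rfl, h⟩
        · obtain ⟨rfl, rfl⟩ := Prod.mk.inj h
          have h1 : ∀ p : P ⊕ Bool, ¬ ∃ p', guardCopy M e p' = (.inl p : GuardedPebble P M) := by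
            rintro p ⟨p', hp⟩; simp [guardCopy] at hp
          have h2 : ∀ a : A, ¬ ∃ p', guardCopy M e p' = (.inr (.inl a) : GuardedPebble P M) := by
            rintro p ⟨p', hp⟩; simp [guardCopy] at hp
          have h3 : G.shift (Function.extend (guardCopy M e) (fun p => (c₁ p).map (guardCopy M e))
              fun z => .jump z) w ∘ Sum.inr ∘ Sum.inl = w ∘ Sum.inr ∘ Sum.inl :=
            funext fun a => G.shift_extend_of_notMem c₁ w (h2 a)
          refine ⟨?_, ?_, b', ?_⟩
          · rw [← ih1]
            exact funext fun p => G.shift_extend_of_notMem c₁ w (h1 p)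
          · dsimp only; rw [h3]; exact ih2
          · dsimp only
            rw [h3]
            refine ih3.tail ⟨c₁, hc₁, ?_⟩
            exact G.shift_extend (guardCopy_injective M e) c₁ w
        · obtain ⟨rfl, rfl⟩ := Prod.mk.inj h
          refine ⟨ih1, ih2.tail ⟨e, rfl, rfl, ?_, ?_⟩⟩
          · exact (hM e G hG _ b').1 ⟨_, ih3⟩
          · funext a
            change (G.shift (retMove mv M e) w) (.inr (.inl a)) = _
            simp only [LGraph.shift, retMove]
            cases mv e a <;> rfl
  exact (key _ hy).2

theorem guarded_lift (G : LGraph.{u} d) (e : E) (q : (M e).Q)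
    (x : (M e).Q × ((A ⊕ Bool) ⊕ (M e).B → G.V)) (w : GuardedPebble P M → G.V)
    (hx : ReflTransGen (G.Trans (M e).δ) (q, w ∘ guardCopy M e) x) :
    ∃ w', ReflTransGen (G.Trans (guardedδ g s₀ src dst mv M))
        (some (.inr ⟨e, q⟩), w) (some (.inr ⟨e, x.1⟩), w') ∧ w' ∘ guardCopy M e = x.2 ∧
        w' ∘ Sum.inl = w ∘ Sum.inl ∧ w' ∘ Sum.inr ∘ Sum.inl = w ∘ Sum.inr ∘ Sum.inl := by
  induction hx with
    | refl => exact ⟨w, .refl, rfl, rfl, rfl⟩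
    | @tail x x' _ h ih =>
      obtain ⟨w', h1, h2, h3, h4⟩ := ih
      obtain ⟨c, hc, hx⟩ := h
      refine ⟨_, h1.tail ⟨_, Or.inl ⟨x'.1, c, ?_, rfl⟩, rfl⟩, ?_, ?_, ?_⟩
      · rw [ker_comp]
        simpa [h2] using hc
      · rw [hx, ← h2]
        exact G.shift_extend (guardCopy_injective M e) c w'
      · rw [← h3]
        refine funext fun p => G.shift_extend_of_notMem c w' ?_
        rintro ⟨p', hp⟩; simp [guardCopy] at hp
      · rw [← h4]
        refine funext fun p => G.shift_extend_of_notMem c w' ?_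
        rintro ⟨p', hp⟩; simp [guardCopy] at hp

/-- Each guarded step is replaced by a call, the lifted accepting run of the subroutine, and the
return move. -/
theorem guarded_complete {guard : E → ∀ G : LGraph.{u} d, (A → G.V) → Prop}
    (hM : ∀ e, ∀ G ∈ F, ∀ ν b, (M e).Accepts G ν b ↔ guard e G ν) {G : LGraph.{u} d} (hG : G ∈ F)
    (ν : P → G.V) (b : GuardedPebble P M → G.V) (hb : b ∘ Sum.inl = G.val ν)
    (z : S × (A → G.V))
    (hz : ReflTransGen (GuardedStep src dst mv guard G) (s₀, G.val ν ∘ g) z) :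
    ∃ w, ReflTransGen (G.Trans (guardedδ g s₀ src dst mv M)) (none, b) (some (.inl z.1), w) ∧
        w ∘ Sum.inl = G.val ν ∧ w ∘ Sum.inr ∘ Sum.inl = z.2 := by
  induction hz with
  | refl => exact ⟨_, .single ⟨_, rfl, rfl⟩, hb, by rw [← hb]; rfl⟩
  | @tail z z' _ h ih =>
    obtain ⟨w, h1, h2, h3⟩ := ih
    obtain ⟨e, he1, he2, he3, he4⟩ := h
    obtain ⟨y', hy'⟩ := (hM e G hG z.2 (w ∘ guardCopy M e ∘ Sum.inr)).2 he3
    rw [← h3, ← shift_callMove M e G w ν h2] at hy'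
    obtain ⟨w', h4, h5, h6, h7⟩ := guarded_lift g s₀ src dst mv M G e _ _ _ hy'
    have h8 : G.shift (callMove M e) w ∘ Sum.inl = w ∘ Sum.inl := rfl
    have h9 : G.shift (callMove M e) w ∘ Sum.inr ∘ Sum.inl = w ∘ Sum.inr ∘ Sum.inl := rfl
    refine ⟨_, ((h1.tail ⟨_, ⟨e, he1, rfl⟩, rfl⟩).trans h4).tail
      ⟨retMove mv M e, Or.inr ⟨rfl, ?_⟩, rfl⟩, ?_, ?_⟩
    · rw [he2]
    · rw [← h2, ← h8, ← h6]; rfl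
    · rw [he4, ← h3, ← h9, ← h7]
      funext a
      change (G.shift (retMove mv M e) w') (.inr (.inl a)) = _
      simp only [LGraph.shift, retMove]
      cases mv e a <;> rfl

/-- The source of the closure properties below, which arise from particular choices of control
states and edges. -/
theorem guarded (s₁ : S) [Finite A] [Finite S] [Finite E]
    {guard : E → ∀ G : LGraph.{u} d, (A → G.V) → Prop} (hguard : ∀ e, Recog F A (guard e)) :
    Recog F P fun G ν => ∃ y, ReflTransGen (GuardedStep src dst mv guard G)
      (s₀, G.val ν ∘ g) (s₁, y) := by
  choose M hM using hguard
  have := fun e => (M e).finiteQ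
  have := fun e => (M e).finiteB
  refine ⟨⟨GuardedState S M, A ⊕ Σ e, ((A ⊕ Bool) ⊕ (M e).B), inferInstance, inferInstance, none,
    some (.inl s₁), guardedδ g s₀ src dst mv M⟩, fun G hG ν b => ⟨?_, ?_⟩⟩
  · rintro ⟨y, hy⟩
    exact ⟨_, guarded_sound g s₀ src dst mv M hM hG ν _ rfl _ _ hy⟩
  · rintro ⟨y, hy⟩
    obtain ⟨w, hw, -⟩ := guarded_complete g s₀ src dst mv M hM hG ν (Sum.elim (G.val ν) b) rfl _ hy
    exact ⟨w, hw⟩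

end guarded

theorem _root_.NDJag.step_iff_trans (J : NDJag d) (G : LGraph.{u} d) (x y : J.ID G) :
    J.Step G x y ↔ G.Trans J.δ (x.state, x.node) (y.state, y.node) := by
  have : ∀ c, J.moveAll G x.node c = G.shift c x.node := fun c => by
    funext p
    simp only [NDJag.moveAll, LGraph.shift]
    cases c p <;> rfl
  simp only [NDJag.Step, LGraph.Trans, this]

/-- A recognizable predicate without variables is decided by an automaton for graphs. -/
theorem exists_jag {φ : ∀ G : LGraph.{u} d, (Empty → G.V) → Prop} (h : Recog F Empty φ) :
    ∃ J : NDJag d, ∀ G ∈ F, J.Accepts G ↔ φ G Empty.elim := by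
  obtain ⟨M, hM⟩ := h
  have := M.finiteQ
  have := M.finiteB
  let J : NDJag d := ⟨M.Q, (Empty ⊕ Bool) ⊕ M.B, inferInstance, inferInstance, M.q₀, M.qa,
    .inl (.inr false), .inl (.inr true), by simp, M.δ⟩
  refine ⟨J, fun G hG => ?_⟩
  -- The scratch pebbles of the automaton begin on the start node, one of the placements the
  -- recognizer must tolerate.
  rw [← hM G hG Empty.elim fun _ => G.startnode]
  have hinit : (J.initial G).node = Sum.elim (G.val Empty.elim) fun _ => G.startnode := by
    funext p
    rcases p with (p | b) | b
    · exact p.elim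
    · cases b <;> simp [NDJag.initial, J]
    · simp [NDJag.initial, J]
  constructor
  · rintro ⟨l, h1, h2, x, hx, hxa⟩
    obtain ⟨l, rfl⟩ : ∃ l', l = J.initial G :: l' := by
      cases l with
      | nil => simp at h1
      | cons a l => simp at h1; exact ⟨l, by rw [h1]⟩
    have := List.relationReflTransGen_of_exists_isChain_cons l h2 rfl
    have hx' : (J.initial G :: l).getLast (by simp) = x := by
      rw [List.getLast?_eq_some_getLast (by simp)] at hx
      simpa using hx
    rw [hx'] at this
    refine ⟨x.node, ?_⟩
    have h3 := ReflTransGen.lift (r := J.Step G) (p := G.Trans M.δ) (fun x : J.ID G => (x.state, x.node))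
      (fun a b h => (J.step_iff_trans G a b).1 h) _ _ this
    dsimp only [Function.onFun] at h3
    rw [hxa, hinit] at h3
    exact h3
  · rintro ⟨y, hy⟩
    have h3 : ReflTransGen (J.Step G) ⟨M.q₀, _⟩ ⟨M.qa, y⟩ :=
      
      ReflTransGen.lift (r := G.Trans M.δ) (p := J.Step G)
        (fun x : M.Q × ((Empty ⊕ Bool) ⊕ M.B → G.V) => (⟨x.1, x.2⟩ : J.ID G)) 
        (fun a b h => (J.step_iff_trans G _ _).2 h) _ _ hy
    obtain ⟨l, h4, h5⟩ := List.exists_isChain_cons_of_relationReflTransGen h3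
    refine ⟨_, ?_, h4, ?_⟩
    · simp only [List.head?_cons, Option.some.injEq]
      rw [← hinit]; rfl
    · rw [List.getLast?_eq_some_getLast (by simp), h5]
      exact ⟨_, rfl, rfl⟩

end Recog

/-! ### Closure under positive connectives, substitution and moves -/

namespace Recog

variable {d : ℕ} {F : Set (LGraph.{u} d)} {P : Type}

theorem congr {φ ψ : ∀ G : LGraph.{u} d, (P → G.V) → Prop} (h : Recog F P φ)
    (hφψ : ∀ G ∈ F, ∀ ν, φ G ν ↔ ψ G ν) : Recog F P ψ := by
  obtain ⟨M, hM⟩ := h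
  exact ⟨M, fun G hG ν b => (hM G hG ν b).trans (hφψ G hG ν)⟩

/-- The incidence relation of the pebbles is recognizable. -/
theorem ker (Z : Set (Setoid P)) : Recog F P fun _ ν => Setoid.ker ν ∈ Z := by
  refine ⟨⟨Bool, Empty, inferInstance, inferInstance, false, true, fun q r =>
    {z | q = false ∧ r.comap (Sum.inl ∘ Sum.inl) ∈ Z ∧ z = (true, .jump)}⟩, fun G _ ν b => ⟨?_, ?_⟩⟩
  · rintro ⟨y, hy⟩
    rcases hy.cases_head with h | ⟨z, ⟨c, hc, -⟩, -⟩
    · simp at h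
    · exact hc.2.1
  · intro h
    exact ⟨_, .single ⟨_, ⟨rfl, h, rfl⟩, rfl⟩⟩

theorem const [Finite P] (p : Prop) : Recog F P fun _ _ => p :=
  (ker {_r | p}).congr fun _ _ _ => Iff.rfl

theorem eq (i j : P) : Recog F P fun _ ν => ν i = ν j :=
  (ker {r | r i j}).congr fun _ _ _ => Iff.rfl

theorem ne (i j : P) : Recog F P fun _ ν => ν i ≠ ν j :=
  (ker {r | ¬ r i j}).congr fun _ _ _ => Iff.rfl

/-- Finite disjunctions, with a substitution of variables. -/
theorem iEx_sub {A ι : Type} [Finite A] [Finite ι] (g : A → P ⊕ Bool)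
    {φ : ι → ∀ G : LGraph.{u} d, (A → G.V) → Prop} (h : ∀ i, Recog F A (φ i)) :
    Recog F P fun G ν => ∃ i, φ i G (G.val ν ∘ g) := by
  refine (guarded g false (fun _ : ι => false) (fun _ : ι => true) (fun _ => .jump) true h).congr
    fun G _ ν => ⟨?_, ?_⟩
  · rintro ⟨y, hy⟩
    rcases hy.cases_head with h | ⟨z, ⟨i, -, -, hi, -⟩, -⟩
    · simp at h
    · exact ⟨i, hi⟩
  · rintro ⟨i, hi⟩
    exact ⟨_, .single ⟨i, rfl, rfl, hi, rfl⟩⟩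

theorem sub {A : Type} [Finite A] (g : A → P ⊕ Bool)
    {φ : ∀ G : LGraph.{u} d, (A → G.V) → Prop} (h : Recog F A φ) :
    Recog F P fun G ν => φ G (G.val ν ∘ g) :=
  (iEx_sub (ι := Unit) g fun _ => h).congr fun _ _ _ => by simp

theorem iEx [Finite P] {ι : Type} [Finite ι] {φ : ι → ∀ G : LGraph.{u} d, (P → G.V) → Prop}
    (h : ∀ i, Recog F P (φ i)) : Recog F P fun G ν => ∃ i, φ i G ν :=
  iEx_sub Sum.inl h

theorem or [Finite P] {φ ψ : ∀ G : LGraph.{u} d, (P → G.V) → Prop} (hφ : Recog F P φ)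
    (hψ : Recog F P ψ) : Recog F P fun G ν => φ G ν ∨ ψ G ν :=
  (iEx (φ := fun b : Bool => if b then φ else ψ) fun b => by cases b <;> simpa).congr fun _ _ _ =>
    by simp [or_comm]

/-- A test, followed by a move and a second test. -/
theorem seq [Finite P] {φ ψ : ∀ G : LGraph.{u} d, (P → G.V) → Prop} (c : P → PebbleMove d P)
    (hφ : Recog F P φ) (hψ : Recog F P ψ) :
    Recog F P fun G ν => φ G ν ∧ ψ G (G.shift c ν) := by
  have h : ∀ b : Bool, Recog F P (if b then ψ else φ) := fun b => by cases b <;> simpa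
  -- Edge `false` tests `φ` and leads from 0 to 1; edge `true` tests `ψ` and leads from 1 to 2. Both
  -- move by `c`, but the second move is no longer observed.
  refine (guarded Sum.inl (0 : Fin 3) (fun b : Bool => if b then 1 else 0)
    (fun b : Bool => if b then 2 else 1) (fun _ => c) 2 h).congr fun G _ ν => ⟨?_, ?_⟩
  · rintro ⟨y, hy⟩
    rcases hy.cases_head with h | ⟨⟨s, x⟩, ⟨b, h1, h2, h3, h4⟩, hy⟩
    · simp at h
    · cases b <;> simp at h1 h2 h3 h4
      subst h2 h4
      rcases hy.cases_head with h | ⟨⟨s, x⟩, ⟨b, h1, h2, h5, h6⟩, hy⟩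
      · simp at h
      · cases b <;> simp at h1 h2 h5 h6
        exact ⟨h3, h5⟩
  · rintro ⟨h1, h2⟩
    exact ⟨_, .tail (.single (b := (1, G.shift c ν)) ⟨false, rfl, rfl, h1, rfl⟩)
      ⟨true, rfl, rfl, h2, rfl⟩⟩

theorem and [Finite P] {φ ψ : ∀ G : LGraph.{u} d, (P → G.V) → Prop} (hφ : Recog F P φ)
    (hψ : Recog F P ψ) : Recog F P fun G ν => φ G ν ∧ ψ G ν :=
  seq .jump hφ hψ

/-- The test `ψ` after a simultaneous move. -/
theorem shift [Finite P] {ψ : ∀ G : LGraph.{u} d, (P → G.V) → Prop} (c : P → PebbleMove d P)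
    (hψ : Recog F P ψ) : Recog F P fun G ν => ψ G (G.shift c ν) :=
  (seq c (const True) hψ).congr fun _ _ _ => by simp

end Recog

/-! ### Transitive closure -/

/-- One step of the iteration of `φ`, on tuples of reachable nodes and finitely many states. -/
def TCStep {d : ℕ} {P X S : Type} (φ : S → S → ∀ G : LGraph.{u} d, ((X ⊕ X) ⊕ P → G.V) → Prop)
    (G : LGraph.{u} d) (ν : P → G.V) (a b : S × (X → G.V)) : Prop :=
  (∀ i, G.Reachable (b.2 i)) ∧ φ a.1 b.1 G (Sum.elim (Sum.elim a.2 b.2) ν)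

namespace Recog

variable {d : ℕ} {F : Set (LGraph.{u} d)} {P : Type}

section tc

variable {X S : Type}

/-- The edges of the automaton that iterates a step: guess the next tuple, step, or finish. -/
abbrev TCEdge (d : ℕ) (X S : Type) : Type := (S × X × Option (Fin d)) ⊕ ((S × S) ⊕ S)

def tcSrc : TCEdge d X S → Option S :=
  Sum.elim (fun e => some e.1) (Sum.elim (fun e => some e.1) some)

def tcDst : TCEdge d X S → Option S :=
  Sum.elim (fun e => some e.1) (Sum.elim (fun e => some e.2) fun _ => none)

open Classical in
/-- The pebbles are the current tuple, the guess for the next one, the parameters, and one that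
rests on the start node. -/
noncomputable def tcMove :
    TCEdge d X S → ((X ⊕ X) ⊕ P) ⊕ Unit → PebbleMove d (((X ⊕ X) ⊕ P) ⊕ Unit)
  | .inl (_, i, o), .inl (.inl (.inr j)) =>
    if j = i then o.elim (.jump (.inr ())) .move else .jump (.inl (.inl (.inr j)))
  | .inr (.inl _), .inl (.inl (.inl j)) => .jump (.inl (.inl (.inr j)))
  | _, p => .jump p

/-- The placement of the pebbles of the automaton that iterates a step. -/
def tcPlace (G : LGraph.{u} d) (ν : P → G.V) (x y : X → G.V) : ((X ⊕ X) ⊕ P) ⊕ Unit → G.V :=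
  Sum.elim (Sum.elim (Sum.elim x y) ν) fun _ => G.startnode

open Classical in
theorem shift_tcMove_guess (G : LGraph.{u} d) (ν : P → G.V) (x y : X → G.V) (s : S) (i : X)
    (o : Option (Fin d)) : G.shift (tcMove (.inl (s, i, o))) (tcPlace G ν x y) =
      tcPlace G ν x (Function.update y i (o.elim G.startnode (G.next (y i)))) := by
  funext p
  rcases p with ((j | j) | j) | j
  · rfl
  · by_cases h : j = i
    · subst h
      cases o <;> simp only [LGraph.shift, tcMove, tcPlace, if_true, Option.elim, Sum.elim_inl,
        Sum.elim_inr, Function.update_self]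
    · simp only [LGraph.shift, tcMove, tcPlace, h, if_false, Sum.elim_inl, Sum.elim_inr, ne_eq,
        not_false_eq_true, Function.update_of_ne]
  · rfl
  · rfl

theorem shift_tcMove_step (G : LGraph.{u} d) (ν : P → G.V) (x y : X → G.V) (e : S × S) :
    G.shift (tcMove (.inr (.inl e))) (tcPlace G ν x y) = tcPlace G ν y y := by
  funext p
  rcases p with ((j | j) | j) | j <;> rfl

theorem shift_tcMove_stop (G : LGraph.{u} d) (ν : P → G.V) (x y : X → G.V) (e : S) :
    G.shift (tcMove (.inr (.inr e))) (tcPlace G ν x y) = tcPlace G ν x y := by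
  funext p
  rcases p with ((j | j) | j) | j <;> rfl

/-- One coordinate at a time: reset the pebble to the start node, then walk along a path to the
desired node. -/
theorem exists_guess [Finite X] {guard : TCEdge d X S → ∀ G : LGraph.{u} d,
      (((X ⊕ X) ⊕ P) ⊕ Unit → G.V) → Prop} (G : LGraph.{u} d) (ν : P → G.V)
    (hg : ∀ e w, guard (.inl e) G w) (s : S) (x y z : X → G.V) (hz : ∀ i, G.Reachable (z i)) :
    ReflTransGen (GuardedStep tcSrc tcDst tcMove guard G)
      (some s, tcPlace G ν x y) (some s, tcPlace G ν x z) := by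
  classical
  have := Fintype.ofFinite X
  have one : ∀ (y : X → G.V) (i : X) (v : G.V), G.Reachable v →
      ReflTransGen (GuardedStep tcSrc tcDst tcMove guard G)
        (some s, tcPlace G ν x y) (some s, tcPlace G ν x (Function.update y i v)) := by
    rintro y i _ ⟨w, rfl⟩
    induction w using List.reverseRecOn with
    | nil =>
      exact .single ⟨.inl (s, i, none), rfl, rfl, hg _ _, by
        rw [shift_tcMove_guess]; rfl⟩
    | append_singleton w a ih =>
      refine ih.tail ⟨.inl (s, i, some a), rfl, rfl, hg _ _, ?_⟩
      simp [shift_tcMove_guess, LGraph.walk]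
  have many : ∀ t : Finset X, ReflTransGen (GuardedStep tcSrc tcDst tcMove guard G)
      (some s, tcPlace G ν x y) (some s, tcPlace G ν x fun i => if i ∈ t then z i else y i) := by
    intro t
    induction t using Finset.induction_on with
    | empty => simpa using .refl
    | insert a t ha ih =>
      convert ih.trans (one _ a (z a) (hz a)) using 4 with i
      by_cases h : i = a
      · subst h; simp
      · simp [h]
  simpa using many Finset.univ

/-- Recognizable predicates are closed under iteration, and in particular under quantification over
reachable nodes. -/
theorem tc [Finite P] [Finite X] [Finite S] (g : X → P ⊕ Bool) (s₀ : S)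
    {φ : S → S → ∀ G : LGraph.{u} d, ((X ⊕ X) ⊕ P → G.V) → Prop}
    {ψ : S → ∀ G : LGraph.{u} d, (X ⊕ P → G.V) → Prop}
    (hφ : ∀ s s', Recog F _ (φ s s')) (hψ : ∀ s, Recog F _ (ψ s)) :
    Recog F P fun G ν => ∃ s y, ReflTransGen (TCStep φ G ν) (s₀, G.val ν ∘ g) (s, y) ∧
      ψ s G (Sum.elim y ν) := by
  let guard : TCEdge d X S → ∀ G : LGraph.{u} d, (((X ⊕ X) ⊕ P) ⊕ Unit → G.V) → Prop :=
    Sum.elim (fun _ _ _ => True) (Sum.elim (fun e G w => φ e.1 e.2 G (w ∘ Sum.inl))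
      fun s G w => ψ s G (Sum.elim (w ∘ Sum.inl ∘ Sum.inl ∘ Sum.inl) (w ∘ Sum.inl ∘ Sum.inr)))
  have hguard : ∀ e, Recog F _ (guard e) := by
    rintro (e | e | s)
    · exact const True
    · exact (sub (P := ((X ⊕ X) ⊕ P) ⊕ Unit) (A := (X ⊕ X) ⊕ P) (fun p => .inl (.inl p))
        (hφ e.1 e.2)).congr fun _ _ _ => Iff.rfl
    · refine (sub (P := ((X ⊕ X) ⊕ P) ⊕ Unit) (A := X ⊕ P) (Sum.elim (fun i => .inl (.inl (.inl (.inl i))))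
        fun p => .inl (.inl (.inr p))) (hψ s)).congr fun G _ w => Iff.of_eq ?_
      simp only [guard, Sum.elim_inr]
      congr 1
      funext p
      cases p <;> rfl
  let g' : ((X ⊕ X) ⊕ P) ⊕ Unit → P ⊕ Bool :=
    Sum.elim (Sum.elim (Sum.elim g fun _ => .inr false) .inl) fun _ => .inr false
  refine (guarded g' (some s₀) tcSrc tcDst tcMove none hguard).congr fun G _ ν => ?_
  have hg' : G.val ν ∘ g' = tcPlace G ν (G.val ν ∘ g) fun _ => G.startnode := by
    funext p
    rcases p with ((j | j) | j) | j <;> rfl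
  rw [hg']
  constructor
  · rintro ⟨w, hw⟩
    let T : S → (X → G.V) → Prop := fun s x =>
      ReflTransGen (TCStep φ G ν) (s₀, G.val ν ∘ g) (s, x)
    -- The guess pebbles begin on the start node and are only reset or moved along edges, so they
    -- remain on reachable nodes. Nothing is asserted about the reachability of the initial tuple.
    let Inv : Option S × (((X ⊕ X) ⊕ P) ⊕ Unit → G.V) → Prop := fun z =>
      ∃ x y, z.2 = tcPlace G ν x y ∧ (∀ i, G.Reachable (y i)) ∧
        z.1.elim (∃ s, T s x ∧ ψ s G (Sum.elim x ν)) fun s => T s x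
    have key : ∀ z, ReflTransGen (GuardedStep tcSrc tcDst tcMove guard G)
        (some s₀, tcPlace G ν (G.val ν ∘ g) fun _ => G.startnode) z → Inv z := by
      intro z hz
      induction hz with
      | refl => exact ⟨_, _, rfl, fun _ => G.reachable_startnode, .refl⟩
      | @tail z z' _ h ih =>
        classical
        obtain ⟨q, w⟩ := z
        obtain ⟨q', w'⟩ := z'
        obtain ⟨x, y, rfl, hy, hT⟩ := ih
        obtain ⟨e, h1, h2, h3, h4⟩ := h
        dsimp only at h1 h2 h3 h4
        subst h1 h2 h4
        rcases e with ⟨s, i, o⟩ | e | s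
        · refine ⟨x, _, shift_tcMove_guess .., fun j => ?_, hT⟩
          by_cases h : j = i
          · subst h
            cases o with
            | none => simpa using G.reachable_startnode
            | some a => simpa using (hy j).next a
          · simpa [h] using hy j
        · exact ⟨y, y, shift_tcMove_step .., hy, ReflTransGen.tail hT ⟨hy, h3⟩⟩
        · exact ⟨x, y, shift_tcMove_stop (e := s) .., hy, s, hT, h3⟩
    obtain ⟨x, -, -, -, s, hs, hψ⟩ := key _ hw
    exact ⟨s, x, hs, hψ⟩
  · rintro ⟨s, x, hs, hψ⟩
    have key : ∀ z, ReflTransGen (TCStep φ G ν) (s₀, G.val ν ∘ g) z →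
        ∃ y, ReflTransGen (GuardedStep tcSrc tcDst tcMove guard G)
          (some s₀, tcPlace G ν (G.val ν ∘ g) fun _ => G.startnode)
          (some z.1, tcPlace G ν z.2 y) := by
      intro z hz
      induction hz with
      | refl => exact ⟨_, .refl⟩
      | @tail z z' _ h ih =>
        obtain ⟨y, hy⟩ := ih
        exact ⟨_, (hy.trans (exists_guess G ν (fun _ _ => trivial) z.1 z.2 y z'.2 h.1)).tail
          ⟨.inr (.inl (z.1, z'.1)), rfl, rfl, h.2, (shift_tcMove_step ..).symm⟩⟩
    obtain ⟨y, hy⟩ := key _ hs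
    exact ⟨_, hy.tail ⟨.inr (.inr s), rfl, rfl, hψ, rfl⟩⟩

end tc

end Recog

/-! ### Running an automaton under supervision -/

/-- The finite automaton with transitions `φ` has a run on `l` from the given state to `σ₁`. -/
def Monitored {T V : Type*} (φ : T → T → V → Prop) (σ₁ : T) : T → List V → Prop
  | σ, [] => σ = σ₁
  | σ, v :: l => ∃ τ, φ σ τ v ∧ Monitored φ σ₁ τ l

namespace Recog

variable {d : ℕ} {F : Set (LGraph.{u} d)} {P : Type}

section monitor

variable (J : NDJag d) {T : Type}

/-- The edges of the automaton that simulates `J` under supervision: steps of `J`, or the end. -/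
abbrev MonitorEdge (T : Type) : Type :=
  ((J.Q × T) × (J.Q × T) × (J.P → PebbleMove d J.P)) ⊕ T

def monitorSrc : MonitorEdge J T → Option (J.Q × T) :=
  Sum.elim (fun e => some e.1) fun σ => some (J.qa, σ)

def monitorDst : MonitorEdge J T → Option (J.Q × T) :=
  Sum.elim (fun e => some e.2.1) fun _ => none

def monitorMove : MonitorEdge J T → J.P ⊕ P → PebbleMove d (J.P ⊕ P)
  | .inl e, .inl p => (e.2.2 p).map .inl
  | _, p => .jump p

theorem shift_monitorMove (G : LGraph.{u} d) (e : (J.Q × T) × (J.Q × T) × (J.P → PebbleMove d J.P))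
    (w : J.P ⊕ P → G.V) : G.shift (monitorMove J (.inl e)) w =
      Sum.elim (G.shift e.2.2 (w ∘ Sum.inl)) (w ∘ Sum.inr) := by
  funext p
  rcases p with p | p
  · simp only [LGraph.shift, monitorMove, Sum.elim_inl]
    cases e.2.2 p <;> rfl
  · rfl

/-- The start of a monitored accepting computation can be found by an automaton. -/
theorem monitor [Finite P] [Finite T] (curr : J.P) (σ₀ σ₁ : T)
    {φ : T → T → ∀ G : LGraph.{u} d, (Option P → G.V) → Prop}
    (hφ : ∀ σ τ, Recog F (Option P) (φ σ τ)) :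
    Recog F P fun G ν => ∃ l, J.IsAcceptingComputation G l ∧
      Monitored (fun σ τ v => φ σ τ G fun o => o.elim v ν) σ₁ σ₀ (l.map fun x => x.node curr) := by
  classical
  have := J.finiteQ
  have := J.finiteP
  -- The stopping edge also carries a test: `Monitored` makes one transition per description, the
  -- last one included.
  let guard : MonitorEdge J T → ∀ G : LGraph.{u} d, (J.P ⊕ P → G.V) → Prop :=
    Sum.elim (fun e G w => Setoid.ker (w ∘ Sum.inl) ∈ {r | (e.2.1.1, e.2.2) ∈ J.δ e.1.1 r} ∧
        φ e.1.2 e.2.1.2 G fun o => o.elim (w (.inl curr)) (w ∘ Sum.inr))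
      fun σ G w => φ σ σ₁ G fun o => o.elim (w (.inl curr)) (w ∘ Sum.inr)
  have hφ' : ∀ σ τ, Recog F (J.P ⊕ P) fun G w =>
      φ σ τ G fun o => o.elim (w (.inl curr)) (w ∘ Sum.inr) := fun σ τ => by
    refine (sub (P := J.P ⊕ P) (A := Option P)
      (fun o => o.elim (.inl (.inl curr)) fun p => .inl (.inr p)) (hφ σ τ)).congr
        fun G _ w => Iff.of_eq ?_
    congr 1
    funext o
    cases o <;> rfl
  have hguard : ∀ e, Recog F _ (guard e) := by
    rintro (e | σ)
    · exact ((sub (P := J.P ⊕ P) (A := J.P) (fun p => .inl (.inl p)) (ker _)).congr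
        fun _ _ _ => Iff.rfl).and (hφ' _ _)
    · exact hφ' _ _
  let g : J.P ⊕ P → P ⊕ Bool := Sum.elim (fun p => .inr (decide (p = J.t))) .inl
  refine (guarded g (some (J.q₀, σ₀)) (monitorSrc J) (monitorDst J) (monitorMove J) none
    hguard).congr fun G _ ν => ?_
  have hg : G.val ν ∘ g = Sum.elim (J.initial G).node ν := by
    funext p
    rcases p with p | p
    · by_cases h : p = J.t <;> simp [g, NDJag.initial, h]
    · rfl
  rw [hg]
  constructor
  · rintro ⟨y, hy⟩
    have key : ∀ z, ReflTransGen (GuardedStep (monitorSrc J) (monitorDst J) (monitorMove J) guard G)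
        z (none, y) → z.2 ∘ Sum.inr = ν → ∀ q σ, z.1 = some (q, σ) →
        ∃ l : List (J.ID G), (⟨q, z.2 ∘ Sum.inl⟩ :: l).IsChain (J.Step G) ∧
          (∃ x ∈ (⟨q, z.2 ∘ Sum.inl⟩ :: l : List (J.ID G)).getLast?, x.state = J.qa) ∧
          Monitored (fun σ τ v => φ σ τ G fun o => o.elim v ν) σ₁ σ
            ((⟨q, z.2 ∘ Sum.inl⟩ :: l : List (J.ID G)).map fun x => x.node curr) := by
      intro z hz
      induction hz using ReflTransGen.head_induction_on with
      | refl => simp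
      | @head z z' h _ ih =>
        obtain ⟨x, w⟩ := z
        obtain ⟨x', w'⟩ := z'
        obtain ⟨e, h1, h2, h3, h4⟩ := h
        rintro hν q σ rfl
        dsimp only at h1 h2 h3 h4 hν
        subst h2 h4
        rcases e with ⟨a, b, c⟩ | τ
        · obtain rfl : a = (q, σ) := by simpa [monitorSrc] using h1
          rw [shift_monitorMove] at ih
          obtain ⟨l, hl1, hl2, hl3⟩ := ih hν b.1 b.2 rfl
          refine ⟨_ :: l, List.isChain_cons_cons.2 ⟨?_, hl1⟩, ?_, ?_⟩
          · exact (J.step_iff_trans G _ _).2 ⟨c, h3.1, rfl⟩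
          · simpa using hl2
          · refine ⟨b.2, ?_, hl3⟩
            rw [← hν]; exact h3.2
        · obtain ⟨rfl, rfl⟩ : J.qa = q ∧ τ = σ := by simpa [monitorSrc] using h1
          refine ⟨[], List.isChain_singleton _, ⟨_, rfl, rfl⟩, σ₁, ?_, rfl⟩
          rw [← hν]; exact h3
    obtain ⟨l, hl1, hl2, hl3⟩ := key _ hy rfl _ _ rfl
    exact ⟨_, ⟨rfl, hl1, hl2⟩, hl3⟩
  · rintro ⟨l, ⟨h1, h2, h3⟩, h4⟩
    have key : ∀ (l : List (J.ID G)) (a : J.ID G) (σ : T), (a :: l).IsChain (J.Step G) →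
        (∃ x ∈ (a :: l).getLast?, x.state = J.qa) →
        Monitored (fun σ τ v => φ σ τ G fun o => o.elim v ν) σ₁ σ
          ((a :: l).map fun x => x.node curr) →
        ∃ y, ReflTransGen (GuardedStep (monitorSrc J) (monitorDst J) (monitorMove J) guard G)
          (some (a.state, σ), Sum.elim a.node ν) (none, y) := by
      intro l
      induction l with
      | nil =>
        rintro a σ - ⟨x, hx, hxa⟩ ⟨τ, hτ, rfl⟩
        obtain rfl : a = x := by simpa using hx
        exact ⟨_, .single ⟨.inr σ, by simp [monitorSrc, hxa], rfl, hτ, rfl⟩⟩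
      | cons b l ih =>
        rintro a σ hc hlast ⟨τ, hτ, hm⟩
        obtain ⟨hab, hc⟩ := List.isChain_cons_cons.1 hc
        obtain ⟨y, hy⟩ := ih b τ hc (by simpa using hlast) hm
        obtain ⟨c, hc1, hc2⟩ := (J.step_iff_trans G _ _).1 hab
        refine ⟨y, .head ⟨.inl ((a.state, σ), (b.state, τ), c), rfl, rfl, ⟨hc1, hτ⟩, ?_⟩ hy⟩
        rw [shift_monitorMove]
        dsimp only at hc2 ⊢
        rw [hc2]; rfl
    cases l with
    | nil => simp at h1
    | cons a l =>
      obtain rfl : a = J.initial G := by simpa using h1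
      exact key l _ _ h2 h3 h4

theorem monitored_unit {V : Type*} {φ : V → Prop} {l : List V} :
    Monitored (fun _ _ : Unit => φ) () () l ↔ ∀ v ∈ l, φ v := by
  induction l with
  | nil => simp [Monitored]
  | cons a l ih => simp [Monitored, ih]

/-- Universal quantification over the reachable nodes. -/
theorem forall_reachable [Finite P] {curr : J.P} (hJ : ∀ G ∈ F, J.Traverses curr G)
    {φ : ∀ G : LGraph.{u} d, (Option P → G.V) → Prop} (hφ : Recog F (Option P) φ) :
    Recog F P fun G ν => ∀ v, G.Reachable v → φ G fun o => o.elim v ν := by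
  -- The supervisor has a single state and just tests `φ`. Traversal turns "some accepting
  -- computation passes" into "all reachable nodes satisfy `φ`": any accepting computation visits
  -- all of them and nothing else.
  refine (monitor J curr () () fun _ _ => hφ).congr fun G hG ν => ?_
  simp only [monitored_unit]
  constructor
  · rintro ⟨l, hl, h⟩ v hv
    obtain ⟨x, hx, rfl⟩ := ((hJ G hG).2 l hl v).2 hv
    exact h _ (List.mem_map_of_mem hx)
  · intro h
    obtain ⟨l, hl⟩ := (hJ G hG).1
    refine ⟨l, hl, fun v hv => h v ?_⟩
    obtain ⟨x, hx, rfl⟩ := List.mem_map.1 hv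
    exact ((hJ G hG).2 l hl _).1 ⟨x, hx, rfl⟩

end monitor

/-- Automata solve co-st-connectivity on traversable families. -/
theorem exists_jag_not_reachable (h : TraversableFamily F) :
    ∃ J : NDJag d, ∀ G ∈ F, J.Accepts G ↔ ¬ G.Reachable G.targetnode := by
  obtain ⟨J, curr, hJ⟩ := h
  refine exists_jag (φ := fun G _ => ¬ G.Reachable G.targetnode) ?_
  refine (sub (A := Unit) (fun _ => .inr true)
    (forall_reachable J hJ (ne none (some ())))).congr fun G _ ν => ?_
  constructor
  · intro h ht
    exact h _ ht rfl
  · intro h v hv hvt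
    obtain rfl : v = G.targetnode := hvt
    exact h hv

end Recog

/-! ### Predicates of reachable placements -/

/-- Predicates that agree with a recognizable one as long as all variables denote reachable
nodes. -/
def ReachRecog {d : ℕ} (F : Set (LGraph.{u} d)) (P : Type)
    (φ : ∀ G : LGraph.{u} d, (P → G.V) → Prop) : Prop :=
  ∃ ψ : ∀ G : LGraph.{u} d, (P → G.V) → Prop, Recog F P ψ ∧
    ∀ G ∈ F, ∀ ν : P → G.V, (∀ p, G.Reachable (ν p)) → (ψ G ν ↔ φ G ν)

theorem Recog.reachRecog {d : ℕ} {F : Set (LGraph.{u} d)} {P : Type}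
    {φ : ∀ G : LGraph.{u} d, (P → G.V) → Prop} (h : Recog F P φ) : ReachRecog F P φ :=
  ⟨φ, h, fun _ _ _ _ => Iff.rfl⟩

namespace ReachRecog

variable {d : ℕ} {F : Set (LGraph.{u} d)} {P : Type}

theorem congr {φ ψ : ∀ G : LGraph.{u} d, (P → G.V) → Prop} (h : ReachRecog F P φ)
    (hφψ : ∀ G ∈ F, ∀ ν : P → G.V, (∀ p, G.Reachable (ν p)) → (φ G ν ↔ ψ G ν)) :
    ReachRecog F P ψ := by
  obtain ⟨χ, h1, h2⟩ := h
  exact ⟨χ, h1, fun G hG ν hν => (h2 G hG ν hν).trans (hφψ G hG ν hν)⟩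

theorem const [Finite P] (p : Prop) : ReachRecog F P fun _ _ => p :=
  (Recog.const p).reachRecog

theorem and [Finite P] {φ ψ : ∀ G : LGraph.{u} d, (P → G.V) → Prop} (hφ : ReachRecog F P φ)
    (hψ : ReachRecog F P ψ) : ReachRecog F P fun G ν => φ G ν ∧ ψ G ν := by
  obtain ⟨φ', h1, h2⟩ := hφ
  obtain ⟨ψ', h3, h4⟩ := hψ
  exact ⟨_, h1.and h3, fun G hG ν hν => and_congr (h2 G hG ν hν) (h4 G hG ν hν)⟩

theorem or [Finite P] {φ ψ : ∀ G : LGraph.{u} d, (P → G.V) → Prop} (hφ : ReachRecog F P φ)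
    (hψ : ReachRecog F P ψ) : ReachRecog F P fun G ν => φ G ν ∨ ψ G ν := by
  obtain ⟨φ', h1, h2⟩ := hφ
  obtain ⟨ψ', h3, h4⟩ := hψ
  exact ⟨_, h1.or h3, fun G hG ν hν => or_congr (h2 G hG ν hν) (h4 G hG ν hν)⟩

theorem iEx [Finite P] {ι : Type} [Finite ι] {φ : ι → ∀ G : LGraph.{u} d, (P → G.V) → Prop}
    (h : ∀ i, ReachRecog F P (φ i)) : ReachRecog F P fun G ν => ∃ i, φ i G ν := by
  choose ψ h1 h2 using h
  exact ⟨_, Recog.iEx h1, fun G hG ν hν => exists_congr fun i => h2 i G hG ν hν⟩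

theorem iAll [Finite P] {ι : Type} [Finite ι] {φ : ι → ∀ G : LGraph.{u} d, (P → G.V) → Prop}
    (h : ∀ i, ReachRecog F P (φ i)) : ReachRecog F P fun G ν => ∀ i, φ i G ν := by
  classical
  have := Fintype.ofFinite ι
  have key : ∀ s : Finset ι, ReachRecog F P fun G ν => ∀ i ∈ s, φ i G ν := by
    intro s
    induction s using Finset.induction_on with
    | empty => exact (const True).congr fun _ _ _ _ => by simp
    | insert a s ha ih => exact ((h a).and ih).congr fun _ _ _ _ => by simp
  exact (key Finset.univ).congr fun _ _ _ _ => by simp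

theorem sub {A : Type} [Finite A] (g : A → P) {φ : ∀ G : LGraph.{u} d, (A → G.V) → Prop}
    (h : ReachRecog F A φ) : ReachRecog F P fun G ν => φ G fun a => ν (g a) := by
  obtain ⟨ψ, h1, h2⟩ := h
  exact ⟨_, h1.sub fun a => .inl (g a), fun G hG ν hν => h2 G hG _ fun a => hν (g a)⟩

/-- The iteration starts on reachable nodes and each step lands on reachable nodes, so the
recognizable substitutes agree with the given predicates all along a run. -/
theorem tc [Finite P] {X S : Type} [Finite X] [Finite S] (g : X → Option P) (s₀ : S)
    {φ : S → S → ∀ G : LGraph.{u} d, ((X ⊕ X) ⊕ P → G.V) → Prop}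
    {ψ : S → ∀ G : LGraph.{u} d, (X ⊕ P → G.V) → Prop}
    (hφ : ∀ s s', ReachRecog F _ (φ s s')) (hψ : ∀ s, ReachRecog F _ (ψ s)) :
    ReachRecog F P fun G ν => ∃ s y,
      ReflTransGen (TCStep φ G ν) (s₀, fun i => (g i).elim G.startnode ν) (s, y) ∧
      (∀ i, G.Reachable (y i)) ∧ ψ s G (Sum.elim y ν) := by
  choose φ' h1 h2 using hφ
  choose ψ' h3 h4 using hψ
  refine ⟨_, Recog.tc (fun i => (g i).elim (.inr false) .inl) s₀ h1 h3, fun G hG ν hν => ?_⟩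
  have hg : (G.val ν ∘ fun i => (g i).elim (.inr false) .inl) =
      fun i => (g i).elim G.startnode ν := by
    funext i
    simp only [Function.comp]
    cases g i <;> rfl
  rw [hg]
  have h0 : ∀ i, G.Reachable ((g i).elim G.startnode ν) := fun i => by
    cases g i with
    | none => exact G.reachable_startnode
    | some p => exact hν p
  have hr : ∀ {φ : S → S → ∀ G : LGraph.{u} d, ((X ⊕ X) ⊕ P → G.V) → Prop} (z),
      ReflTransGen (TCStep φ G ν) (s₀, fun i => (g i).elim G.startnode ν) z →
      ∀ i, G.Reachable (z.2 i) := by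
    intro φ z hz
    cases hz with
    | refl => exact h0
    | tail _ h => exact h.1
  have hstep : ∀ a b : S × (X → G.V), (∀ i, G.Reachable (a.2 i)) →
      (TCStep φ' G ν a b ↔ TCStep φ G ν a b) := fun a b ha =>
    and_congr_right fun hb => h2 _ _ G hG _ (by rintro ((i | i) | p) <;> simp [ha, hb, hν])
  have heq : ∀ z, ReflTransGen (TCStep φ' G ν) (s₀, fun i => (g i).elim G.startnode ν) z ↔
      ReflTransGen (TCStep φ G ν) (s₀, fun i => (g i).elim G.startnode ν) z := by
    intro z
    constructor
    · intro hz
      induction hz with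
      | refl => exact .refl
      | tail hz h ih => exact ih.tail ((hstep _ _ (hr _ hz)).1 h)
    · intro hz
      induction hz with
      | refl => exact .refl
      | tail hz h ih => exact ih.tail ((hstep _ _ (hr _ hz)).2 h)
  refine exists_congr fun s => exists_congr fun y => ?_
  rw [heq]
  refine and_congr_right fun hy => ?_
  have := hr _ hy
  rw [h4 s G hG _ (by rintro (i | p) <;> simp [hν]; exact this i)]
  exact (and_iff_right this).symm

/-- Existential quantification over several reachable nodes. -/
theorem ex [Finite P] {B : Type} [Finite B] {φ : ∀ G : LGraph.{u} d, (B ⊕ P → G.V) → Prop}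
    (h : ReachRecog F (B ⊕ P) φ) : ReachRecog F P fun G ν =>
      ∃ ξ : B → G.V, (∀ i, G.Reachable (ξ i)) ∧ φ G (Sum.elim ξ ν) := by
  refine (tc (φ := fun _ _ _ _ => True) (fun _ : B => (none : Option P)) () (fun _ _ => const True)
    fun _ => h).congr fun G _ ν _ => ⟨?_, ?_⟩
  · rintro ⟨-, y, -, h⟩
    exact ⟨y, h⟩
  · rintro ⟨y, h⟩
    exact ⟨(), y, .single ⟨h.1, trivial⟩, h⟩

theorem forall_reachable [Finite P] (J : NDJag d) {curr : J.P} (hJ : ∀ G ∈ F, J.Traverses curr G)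
    {φ : ∀ G : LGraph.{u} d, (Option P → G.V) → Prop} (hφ : ReachRecog F (Option P) φ) :
    ReachRecog F P fun G ν => ∀ v, G.Reachable v → φ G fun o => o.elim v ν := by
  obtain ⟨ψ, h1, h2⟩ := hφ
  refine ⟨_, h1.forall_reachable J hJ, fun G hG ν hν => ?_⟩
  refine forall_congr' fun v => imp_congr_right fun hv => h2 G hG _ ?_
  rintro (_ | p)
  · exact hv
  · exact hν p

theorem eq (i j : P) : ReachRecog F P fun _ ν => ν i = ν j := (Recog.eq i j).reachRecog

/-- The start node, and its complement. -/
theorem start [Finite P] (i : P) (b : Bool) :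
    ReachRecog F P fun G ν => b = true ↔ G.startnode = ν i := by
  have : Recog F (Option P) fun G ν => b = true ↔ ν none = ν (some i) :=
    (Recog.ker {r | b = true ↔ r none (some i)}).congr fun _ _ _ => Iff.rfl
  exact ((this.sub fun o => o.elim (.inr false) .inl).congr fun _ _ _ => Iff.rfl).reachRecog

/-- The target node, and its complement. -/
theorem target [Finite P] (i : P) (b : Bool) :
    ReachRecog F P fun G ν => b = true ↔ G.targetnode = ν i := by
  have : Recog F (Option P) fun G ν => b = true ↔ ν none = ν (some i) :=
    (Recog.ker {r | b = true ↔ r none (some i)}).congr fun _ _ _ => Iff.rfl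
  exact ((this.sub fun o => o.elim (.inr true) .inl).congr fun _ _ _ => Iff.rfl).reachRecog

/-- The edges with a given label, and their complement. -/
theorem edge [Finite P] (a : Fin d) (i j : P) (b : Bool) :
    ReachRecog F P fun G ν => b = true ↔ G.next (ν i) a = ν j := by
  have : Recog F (Option P) fun G ν => b = true ↔ ν none = ν (some j) :=
    (Recog.ker {r | b = true ↔ r none (some j)}).congr fun _ _ _ => Iff.rfl
  -- An auxiliary pebble is put on `ν i`, moved along the edge, and compared with `ν j`.
  exact (((this.shift fun o => o.elim (.move a) fun p => .jump (some p)).sub fun o =>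
    o.elim (.inl i) .inl).congr fun _ _ _ => Iff.rfl).reachRecog

end ReachRecog

/-! ### The order of first visits -/

section before

variable {V : Type*}

/-- In the list, `a` occurs, and its first occurrence is before any occurrence of `b`. -/
def Before (a b : V) : List V → Prop
  | [] => False
  | v :: l => (v = a ∧ v ≠ b) ∨ (v ≠ a ∧ v ≠ b ∧ Before a b l)

/-- The index of a missing element is the length of the list, which covers the case that `b` does
not occur. -/
theorem before_iff_idxOf [DecidableEq V] (a b : V) (l : List V) :
    Before a b l ↔ l.idxOf a < l.idxOf b := by
  induction l with
  | nil => simp [Before]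
  | cons v l ih =>
    by_cases ha : v = a <;> by_cases hb : v = b
    · simp [Before, ← ha, ← hb]
    · subst ha
      simp [Before, List.idxOf_cons_ne _ hb, hb]
    · subst hb
      simp [Before]
    · simp [Before, ih, List.idxOf_cons_ne _ hb, List.idxOf_cons_ne _ ha, ha, hb]

/-- Deleting immediate repetitions does not change the order of first occurrences, so the
computations of an ordering automaton agree on it even though they may pause differently. -/
theorem before_destutter [DecidableEq V] (a b : V) (l : List V) :
    Before a b (l.destutter (· ≠ ·)) ↔ Before a b l := by
  have key : ∀ (l : List V) v, Before a b (l.destutter' (· ≠ ·) v) ↔ Before a b (v :: l) := by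
    intro l
    induction l with
    | nil => simp
    | cons w l ih =>
      intro v
      by_cases h : v = w
      · subst h
        rw [List.destutter'_cons_neg _ (by simp), ih]
        simp only [Before]
        tauto
      · rw [List.destutter'_cons_pos _ h]
        simp only [Before, ih]
  cases l with
  | nil => simp
  | cons v l => exact key l v

/-- The transitions of an automaton that waits for `a` or `b`. -/
def beforeTransition : Bool → Bool → V → V → V → Prop
  | false, false => fun a b v => v ≠ a ∧ v ≠ b
  | false, true => fun a b v => v = a ∧ v ≠ b
  | true, s => fun _ _ _ => s = true

theorem monitored_before (a b : V) (l : List V) :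
    Monitored (fun s s' => beforeTransition s s' a b) true false l ↔ Before a b l := by
  have h : ∀ l : List V, Monitored (fun s s' => beforeTransition s s' a b) true true l := by
    intro l
    induction l with
    | nil => rfl
    | cons v l ih => exact ⟨true, rfl, ih⟩
  induction l with
  | nil => simp [Monitored, Before]
  | cons v l ih =>
    simp only [Monitored, Before, Bool.exists_bool, ih, h]
    simp only [beforeTransition, and_true, and_assoc]
    exact or_comm

end before

/-- The number of reachable nodes. -/
noncomputable def LGraph.order {d : ℕ} (G : LGraph.{u} d) : ℕ :=
  {v | G.Reachable v}.ncard

namespace OrderableFamily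

variable {d : ℕ} {F : Set (LGraph.{u} d)}

/-- `idx` is the time of the first visit in one fixed accepting computation. Other computations may
have different times but have the same order, so supervising any of them decides the comparison. -/
theorem exists_idx (h : OrderableFamily F) :
    ∃ (J : NDJag d) (curr : J.P) (idx : ∀ G : LGraph.{u} d, G.V → ℕ),
      (∀ G ∈ F, J.Traverses curr G) ∧ (∀ G ∈ F, Set.InjOn (idx G) {v | G.Reachable v}) ∧
      Recog F (Fin 2) fun G ν => idx G (ν 0) < idx G (ν 1) := by
  classical
  obtain ⟨J, curr, hJ⟩ := h
  have hex : ∀ G, ∃ l, G ∈ F → J.IsAcceptingComputation G l := fun G => by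
    by_cases hG : G ∈ F
    · obtain ⟨l, hl⟩ := (hJ G hG).1.1
      exact ⟨l, fun _ => hl⟩
    · exact ⟨[], fun h => absurd h hG⟩
  choose l hl using hex
  refine ⟨J, curr, fun G v => ((l G).map fun x => x.node curr).idxOf v, fun G hG => (hJ G hG).1,
    fun G hG a ha b hb hab => ?_, ?_⟩
  · obtain ⟨x, hx, rfl⟩ := ((hJ G hG).1.2 _ (hl G hG) a).2 ha
    exact (List.idxOf_inj (List.mem_map_of_mem (f := fun x : J.ID G => x.node curr) hx)).1 hab
  · have hφ : ∀ s s', Recog F (Option (Fin 2)) fun G ν =>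
        beforeTransition s s' (ν (some 0)) (ν (some 1)) (ν none) := by
      rintro (_ | _) (_ | _)
      · exact (Recog.ne _ _).and (Recog.ne _ _)
      · exact (Recog.eq _ _).and (Recog.ne _ _)
      · exact Recog.const _
      · exact Recog.const _
    refine (Recog.monitor J curr false true hφ).congr fun G hG ν => ?_
    have hmon : ∀ l : List G.V, Monitored (fun s s' v => beforeTransition s s' (ν 0) (ν 1) v)
        true false l ↔ Before (ν 0) (ν 1) l := monitored_before (ν 0) (ν 1)
    have hpl : ∀ l', J.IsAcceptingComputation G l' →
        (Before (ν 0) (ν 1) (l'.map fun x => x.node curr) ↔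
          Before (ν 0) (ν 1) ((l G).map fun x => x.node curr)) := fun l' hl' => by
      rw [← before_destutter, ← before_destutter _ _ ((l G).map _)]
      have := (hJ G hG).2 l' (l G) hl' (hl G hG)
      unfold NDJag.placements at this
      convert Iff.of_eq (congrArg (Before (ν 0) (ν 1)) this)
    rw [← before_iff_idxOf]
    constructor
    · rintro ⟨l', h1, h2⟩
      exact (hpl l' h1).1 ((hmon _).1 h2)
    · intro h
      exact ⟨l G, hl G hG, (hmon _).2 h⟩

/-- The reachable nodes of the graphs of an orderable family can be numbered in such a way that
automata have access to the numbering. -/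
theorem exists_rank (h : OrderableFamily F) :
    ∃ e : ∀ G : LGraph.{u} d, G.V → ℕ,
      (∀ G ∈ F, Set.BijOn (e G) {v | G.Reachable v} (Set.Iio G.order)) ∧
      (ReachRecog F (Fin 2) fun G ν => e G (ν 1) = e G (ν 0) + 1) ∧
      (ReachRecog F Unit fun G ν => e G (ν ()) = 0) ∧
      ReachRecog F Unit fun G ν => e G (ν ()) + 1 = G.order := by
  obtain ⟨J, curr, idx, hJ, hinj, hlt⟩ := h.exists_idx
  -- The rank counts the reachable nodes visited earlier, which closes the gaps that `idx` may have.
  let e : ∀ G : LGraph.{u} d, G.V → ℕ := fun G v => {w | G.Reachable w ∧ idx G w < idx G v}.ncard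
  have hmono : ∀ G, ∀ a b, G.Reachable a → idx G a < idx G b → e G a < e G b := fun G a b ha hab => by
    have := G.finite
    refine Set.ncard_lt_ncard ⟨fun w hw => ⟨hw.1, hw.2.trans hab⟩, fun hsub => ?_⟩
    exact (hsub ⟨ha, hab⟩ : a ∈ {w | G.Reachable w ∧ idx G w < idx G a}).2.false
  have hiff : ∀ G, ∀ a b, G.Reachable a → G.Reachable b →
      (idx G a < idx G b ↔ e G a < e G b) := fun G a b ha hb => by
    refine ⟨hmono G a b ha, fun h => ?_⟩
    rcases lt_trichotomy (idx G a) (idx G b) with h' | h' | h'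
    · exact h'
    · exact absurd h (by simp [e, h'])
    · exact absurd (hmono G b a hb h') (by omega)
  have hbij : ∀ G ∈ F, Set.BijOn (e G) {v | G.Reachable v} (Set.Iio G.order) := fun G hG => by
    have := G.finite
    have hmaps : Set.MapsTo (e G) {v | G.Reachable v} (Set.Iio G.order) := fun v hv =>
      Set.ncard_lt_ncard ⟨fun w hw => hw.1, fun hsub => (hsub hv).2.false⟩
    have hinj' : Set.InjOn (e G) {v | G.Reachable v} := fun a ha b hb hab => by
      refine hinj G hG ha hb (le_antisymm ?_ ?_) <;> by_contra! hc
      · exact absurd (hmono G b a hb hc) (by omega)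
      · exact absurd (hmono G a b ha hc) (by omega)
    refine ⟨hmaps, hinj', ?_⟩
    refine (Set.eq_of_subset_of_ncard_le hmaps.image_subset ?_).ge
    rw [hinj'.ncard_image]
    simp [LGraph.order, Set.ncard_eq_toFinset_card']
  have hlt' : ∀ {P : Type} [Finite P] (i j : P),
      ReachRecog F P fun G ν => e G (ν i) < e G (ν j) := fun i j =>
    (hlt.reachRecog.sub ![i, j]).congr fun G _ ν hν => hiff G _ _ (hν _) (hν _)
  have hle : ∀ {P : Type} [Finite P] (i j : P),
      ReachRecog F P fun G ν => e G (ν i) ≤ e G (ν j) := fun i j =>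
    ((ReachRecog.eq i j).or (hlt' i j)).congr fun G hG ν hν => by
      rw [le_iff_eq_or_lt, (hbij G hG).injOn.eq_iff (hν i) (hν j)]
  refine ⟨e, hbij, ?_, ?_, ?_⟩
  -- Successor, stated positively: `ν 0` is below `ν 1`, and each reachable node is at most `ν 0` or
  -- at least `ν 1`. Surjectivity of the ranks provides a node in between if there is a gap.
  · refine ((hlt' 0 1).and (ReachRecog.forall_reachable J hJ
      ((hle none (some 0)).or (hle (some 1) none)))).congr fun G hG ν hν => ⟨?_, ?_⟩
    · rintro ⟨h1, h2⟩
      by_contra h3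
      obtain ⟨c, hc, hce⟩ := (hbij G hG).surjOn
        (show e G (ν 0) + 1 < G.order from lt_of_le_of_lt h1 ((hbij G hG).mapsTo (hν 1)))
      have := h2 c hc
      dsimp only [Option.elim] at this
      omega
    · intro h
      refine ⟨by omega, fun c hc => ?_⟩
      dsimp only [Option.elim]
      omega
  · refine (ReachRecog.forall_reachable J hJ (hle (some ()) none)).congr fun G hG ν hν => ⟨?_, ?_⟩
    · intro h
      obtain ⟨c, hc, hce⟩ := (hbij G hG).surjOn
        (show 0 ∈ Set.Iio G.order from lt_of_le_of_lt (Nat.zero_le _) ((hbij G hG).mapsTo (hν ())))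
      have := h c hc
      dsimp only [Option.elim] at this
      omega
    · intro h c hc
      dsimp only [Option.elim]
      omega
  · refine (ReachRecog.forall_reachable J hJ (hle none (some ()))).congr fun G hG ν hν => ?_
    have hlt : e G (ν ()) < G.order := (hbij G hG).mapsTo (hν ())
    constructor
    · intro h
      obtain ⟨c, hc, hce⟩ := (hbij G hG).surjOn
        (show G.order - 1 ∈ Set.Iio G.order from Nat.sub_lt (by omega) one_pos)
      have := h c hc
      dsimp only [Option.elim] at this
      omega
    · intro h c hc
      have : e G c < G.order := (hbij G hG).mapsTo hc
      dsimp only [Option.elim]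
      omega

end OrderableFamily

/-! ### Numbers represented by tuples of nodes -/

/-- The numbering `e` of the reachable nodes is accessible to automata on `F`. -/
structure Ranked {d : ℕ} (F : Set (LGraph.{u} d)) (e : ∀ G : LGraph.{u} d, G.V → ℕ) : Prop where
  bijOn : ∀ G ∈ F, Set.BijOn (e G) {v | G.Reachable v} (Set.Iio G.order)
  succ : ReachRecog F (Fin 2) fun G ν => e G (ν 1) = e G (ν 0) + 1
  zero : ReachRecog F Unit fun G ν => e G (ν ()) = 0
  last : ReachRecog F Unit fun G ν => e G (ν ()) + 1 = G.order

/-- The number with digits `e (ξ 0), …, e (ξ (k - 1))` in base `n` and leading digit `f`. -/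
def numVal {V : Type*} (e : V → ℕ) (n : ℕ) : (k : ℕ) → ℕ → (Fin k → V) → ℕ
  | 0, f, _ => f
  | k + 1, f, ξ => e (ξ 0) + n * numVal e n k f fun j => ξ j.succ

theorem numVal_lt {V : Type*} {e : V → ℕ} {n K f : ℕ} (hf : f < K) :
    ∀ {k : ℕ} {ξ : Fin k → V}, (∀ j, e (ξ j) < n) → numVal e n k f ξ < K * n ^ k
  | 0, _, _ => by simpa [numVal]
  | k + 1, ξ, h => by
    have := numVal_lt hf (ξ := fun j => ξ j.succ) fun j => h _
    calc e (ξ 0) + n * numVal e n k f (fun j => ξ j.succ)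
        < n * (numVal e n k f (fun j => ξ j.succ) + 1) := by have := h 0; linarith
      _ ≤ n * (K * n ^ k) := Nat.mul_le_mul_left _ this
      _ = K * n ^ (k + 1) := by ring

/-- Division with remainder by `n`: the remainder is the rank of the lowest digit, and the quotient
is represented recursively. -/
theorem exists_numVal {V : Type*} {e : V → ℕ} {s : Set V} {n K : ℕ}
    (h : Set.SurjOn e s (Set.Iio n)) : ∀ {k m : ℕ}, m < K * n ^ k →
      ∃ (f : Fin K) (ξ : Fin k → V), (∀ j, ξ j ∈ s) ∧ numVal e n k f ξ = m
  | 0, m, hm => ⟨⟨m, by simpa using hm⟩, Fin.elim0, fun j => j.elim0, rfl⟩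
  | k + 1, m, hm => by
    have hn : 0 < n := by
      by_contra h0
      simp [show n = 0 by omega] at hm
    have h1 : m / n < K * n ^ k := by
      rw [Nat.div_lt_iff_lt_mul hn]
      simpa [pow_succ, mul_assoc] using hm
    obtain ⟨f, ξ, hξ, hv⟩ := exists_numVal h h1
    obtain ⟨v, hv1, hv2⟩ := h (show m % n ∈ Set.Iio n from Nat.mod_lt _ hn)
    refine ⟨f, Fin.cons v ξ, fun j => ?_, ?_⟩
    · refine Fin.cases ?_ (fun j => ?_) j
      · simpa using hv1
      · simpa using hξ j
    · simp [numVal, hv, hv2, Nat.mod_add_div]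

theorem digits_eq_iff {n a b A B : ℕ} (ha : a < n) (hb : b < n) :
    a + n * A = b + n * B ↔ a = b ∧ A = B := by
  refine ⟨fun h => ?_, by rintro ⟨rfl, rfl⟩; rfl⟩
  have h1 := congrArg (· % n) h
  simp only [Nat.add_mul_mod_self_left, Nat.mod_eq_of_lt, ha, hb] at h1
  subst h1
  exact ⟨rfl, Nat.eq_of_mul_eq_mul_left (by omega) (Nat.add_left_cancel h)⟩

/-- Either the lowest digit grows by one, or it is `n - 1` and there is a carry. -/
theorem digits_eq_succ_iff {n a b A B : ℕ} (ha : a < n) (hb : b < n) :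
    b + n * B = a + n * A + 1 ↔ (b = a + 1 ∧ B = A) ∨ ((a + 1 = n ∧ b = 0) ∧ B = A + 1) := by
  rcases Nat.lt_or_ge (a + 1) n with h | h
  · rw [show a + n * A + 1 = (a + 1) + n * A by ring, digits_eq_iff hb h]
    omega
  · obtain rfl : n = a + 1 := by omega
    rw [show a + (a + 1) * A + 1 = 0 + (a + 1) * (A + 1) by ring, digits_eq_iff hb (by omega)]
    omega

namespace Ranked

variable {d : ℕ} {F : Set (LGraph.{u} d)} {e : ∀ G : LGraph.{u} d, G.V → ℕ} {P : Type} [Finite P]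

theorem lt_order (he : Ranked F e) {G : LGraph.{u} d} (hG : G ∈ F) {v : G.V} (hv : G.Reachable v) :
    e G v < G.order := (he.bijOn G hG).mapsTo hv

theorem numVal_zero (he : Ranked F e) (f : ℕ) : ∀ (k : ℕ) (t : Fin k → P),
    ReachRecog F P fun G ν => numVal (e G) G.order k f (fun j => ν (t j)) = 0
  | 0, _ => ReachRecog.const (f = 0)
  | k + 1, t => by
    refine ((he.zero.sub fun _ => t 0).and (he.numVal_zero f k fun j => t j.succ)).congr
      fun G hG ν hν => ?_
    have := he.lt_order hG (hν (t 0))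
    simp [numVal]
    omega

theorem numVal_eq (he : Ranked F e) (f f' : ℕ) : ∀ (k : ℕ) (t t' : Fin k → P),
    ReachRecog F P fun G ν => numVal (e G) G.order k f (fun j => ν (t j)) =
      numVal (e G) G.order k f' (fun j => ν (t' j))
  | 0, _, _ => ReachRecog.const (f = f')
  | k + 1, t, t' => by
    refine ((ReachRecog.eq (t 0) (t' 0)).and (he.numVal_eq f f' k (fun j => t j.succ)
      fun j => t' j.succ)).congr fun G hG ν hν => ?_
    rw [← (he.bijOn G hG).injOn.eq_iff (hν (t 0)) (hν (t' 0))]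
    exact (digits_eq_iff (he.lt_order hG (hν (t 0))) (he.lt_order hG (hν (t' 0)))).symm

theorem numVal_succ (he : Ranked F e) (f f' : ℕ) : ∀ (k : ℕ) (t t' : Fin k → P),
    ReachRecog F P fun G ν => numVal (e G) G.order k f' (fun j => ν (t' j)) =
      numVal (e G) G.order k f (fun j => ν (t j)) + 1
  | 0, _, _ => ReachRecog.const (f' = f + 1)
  | k + 1, t, t' => by
    refine (((he.succ.sub ![t 0, t' 0]).and (he.numVal_eq f' f k (fun j => t' j.succ)
      fun j => t j.succ)).or (((he.last.sub fun _ => t 0).and (he.zero.sub fun _ => t' 0)).and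
        (he.numVal_succ f f' k (fun j => t j.succ) fun j => t' j.succ))).congr fun G hG ν hν => ?_
    exact (digits_eq_succ_iff (he.lt_order hG (hν (t 0))) (he.lt_order hG (hν (t' 0)))).symm

end Ranked

/-- The numbers represented by leading digits `f` and tuples of nodes. -/
noncomputable def decode {d : ℕ} (e : ∀ G : LGraph.{u} d, G.V → ℕ) {K k : ℕ} {N : Type} (f : N → Fin K)
    (G : LGraph.{u} d) (ν : N × Fin k → G.V) (i : N) : ℕ :=
  numVal (e G) G.order k (f i) fun j => ν (i, j)

/-- Predicates of numbers below `K * G.order ^ k` that are recognizable in their representations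
by tuples of nodes. -/
def NumRecog {d : ℕ} (F : Set (LGraph.{u} d)) (e : ∀ G : LGraph.{u} d, G.V → ℕ) (K k : ℕ)
    (N : Type) (φ : LGraph.{u} d → (N → ℕ) → Prop) : Prop :=
  ∀ f : N → Fin K, ReachRecog F (N × Fin k) fun G ν => φ G (decode e f G ν)

/-- One step of the iteration of `φ`, on tuples of bounded numbers and finitely many states. -/
def NumStep {d : ℕ} (K k : ℕ) {N X S : Type}
    (φ : S → S → LGraph.{u} d → ((X ⊕ X) ⊕ N → ℕ) → Prop) (G : LGraph.{u} d) (env : N → ℕ)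
    (a b : S × (X → ℕ)) : Prop :=
  (∀ i, b.2 i < K * G.order ^ k) ∧ φ a.1 b.1 G (Sum.elim (Sum.elim a.2 b.2) env)

namespace NumRecog

variable {d : ℕ} {F : Set (LGraph.{u} d)} {e : ∀ G : LGraph.{u} d, G.V → ℕ} {K k : ℕ} {N : Type}

theorem decode_lt (he : Ranked F e) (f : N → Fin K) {G : LGraph.{u} d} (hG : G ∈ F)
    {ν : N × Fin k → G.V} (hν : ∀ p, G.Reachable (ν p)) (i : N) :
    decode e f G ν i < K * G.order ^ k :=
  numVal_lt (f i).2 fun _ => he.lt_order hG (hν _)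

theorem exists_decode (he : Ranked F e) {G : LGraph.{u} d} (hG : G ∈ F) {m : N → ℕ}
    (hm : ∀ i, m i < K * G.order ^ k) : ∃ (f : N → Fin K) (ν : N × Fin k → G.V),
      (∀ p, G.Reachable (ν p)) ∧ decode e f G ν = m := by
  choose f ξ h1 h2 using fun i => exists_numVal (he.bijOn G hG).surjOn (hm i)
  exact ⟨f, fun p => ξ p.1 p.2, fun p => h1 _ _, funext h2⟩

theorem congr (he : Ranked F e) {φ ψ : LGraph.{u} d → (N → ℕ) → Prop} (h : NumRecog F e K k N φ)
    (hφψ : ∀ G ∈ F, ∀ env : N → ℕ, (∀ i, env i < K * G.order ^ k) → (φ G env ↔ ψ G env)) :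
    NumRecog F e K k N ψ := fun f =>
  (h f).congr fun G hG _ hν => hφψ G hG _ fun i => decode_lt he f hG hν i

theorem const [Finite N] (p : Prop) : NumRecog F e K k N fun _ _ => p :=
  fun _ => ReachRecog.const p

theorem and [Finite N] {φ ψ : LGraph.{u} d → (N → ℕ) → Prop} (hφ : NumRecog F e K k N φ)
    (hψ : NumRecog F e K k N ψ) : NumRecog F e K k N fun G env => φ G env ∧ ψ G env :=
  fun f => (hφ f).and (hψ f)

theorem or [Finite N] {φ ψ : LGraph.{u} d → (N → ℕ) → Prop} (hφ : NumRecog F e K k N φ)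
    (hψ : NumRecog F e K k N ψ) : NumRecog F e K k N fun G env => φ G env ∨ ψ G env :=
  fun f => (hφ f).or (hψ f)

theorem iEx [Finite N] {ι : Type} [Finite ι] {φ : ι → LGraph.{u} d → (N → ℕ) → Prop}
    (h : ∀ i, NumRecog F e K k N (φ i)) : NumRecog F e K k N fun G env => ∃ i, φ i G env :=
  fun f => ReachRecog.iEx fun i => h i f

theorem sub {A : Type} [Finite A] (g : A → N) {φ : LGraph.{u} d → (A → ℕ) → Prop}
    (h : NumRecog F e K k A φ) : NumRecog F e K k N fun G env => φ G fun a => env (g a) :=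
  fun f => (h fun a => f (g a)).sub fun p => (g p.1, p.2)

theorem zero (he : Ranked F e) [Finite N] (i : N) : NumRecog F e K k N fun _ env => env i = 0 :=
  fun f => he.numVal_zero (f i) k fun j => (i, j)

theorem eq (he : Ranked F e) [Finite N] (i j : N) :
    NumRecog F e K k N fun _ env => env i = env j :=
  fun f => he.numVal_eq (f i) (f j) k (fun l => (i, l)) fun l => (j, l)

theorem succ (he : Ranked F e) [Finite N] (i j : N) :
    NumRecog F e K k N fun _ env => env j = env i + 1 :=
  fun f => he.numVal_succ (f i) (f j) k (fun l => (i, l)) fun l => (j, l)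

/-- Predicates of numbers are closed under iteration. -/
theorem tc (he : Ranked F e) [Finite N] {X S : Type} [Finite X] [Finite S] (g : X → N) (s₀ : S)
    {φ : S → S → LGraph.{u} d → ((X ⊕ X) ⊕ N → ℕ) → Prop}
    {ψ : S → LGraph.{u} d → (X ⊕ N → ℕ) → Prop}
    (hφ : ∀ s s', NumRecog F e K k _ (φ s s')) (hψ : ∀ s, NumRecog F e K k _ (ψ s)) :
    NumRecog F e K k N fun G env => ∃ s y,
      ReflTransGen (NumStep K k φ G env) (s₀, fun i => env (g i)) (s, y) ∧
      (∀ i, y i < K * G.order ^ k) ∧ ψ s G (Sum.elim y env) := by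
  intro f
  -- The leading digits join the finite state; the other digits become the tuple of nodes.
  let φ' : S × (X → Fin K) → S × (X → Fin K) → ∀ G : LGraph.{u} d,
      (((X × Fin k) ⊕ (X × Fin k)) ⊕ (N × Fin k) → G.V) → Prop := fun s s' G w =>
    φ s.1 s'.1 G (Sum.elim (Sum.elim (decode e s.2 G fun p => w (.inl (.inl p)))
      (decode e s'.2 G fun p => w (.inl (.inr p)))) (decode e f G fun p => w (.inr p)))
  let ψ' : S × (X → Fin K) → ∀ G : LGraph.{u} d, ((X × Fin k) ⊕ (N × Fin k) → G.V) → Prop :=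
    fun s G w => ψ s.1 G (Sum.elim (decode e s.2 G fun p => w (.inl p))
      (decode e f G fun p => w (.inr p)))
  have hφ' : ∀ s s', ReachRecog F _ (φ' s s') := fun s s' => by
    refine (ReachRecog.sub (P := ((X × Fin k) ⊕ (X × Fin k)) ⊕ (N × Fin k))
      (fun p : ((X ⊕ X) ⊕ N) × Fin k => p.1.elim
        (Sum.elim (fun i => .inl (.inl (i, p.2))) fun i => .inl (.inr (i, p.2)))
        fun i => .inr (i, p.2))
      (hφ s.1 s'.1 (Sum.elim (Sum.elim s.2 s'.2) f))).congr fun G _ w _ => Iff.of_eq ?_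
    dsimp only [φ']
    congr 1
    funext i
    rcases i with (i | i) | i <;> rfl
  have hψ' : ∀ s, ReachRecog F _ (ψ' s) := fun s => by
    refine (ReachRecog.sub (P := (X × Fin k) ⊕ (N × Fin k))
      (fun p : (X ⊕ N) × Fin k => p.1.elim (fun i => .inl (i, p.2)) fun i => .inr (i, p.2))
      (hψ s.1 (Sum.elim s.2 f))).congr fun G _ w _ => Iff.of_eq ?_
    dsimp only [ψ']
    congr 1
    funext i
    rcases i with i | i <;> rfl
  refine (ReachRecog.tc (fun p : X × Fin k => some (g p.1, p.2)) (s₀, fun i => f (g i)) hφ'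
    hψ').congr fun G hG ν hν => ⟨?_, ?_⟩
  · rintro ⟨⟨s, h⟩, y, h1, h2, h3⟩
    refine ⟨s, decode e h G y, ?_, decode_lt he h hG h2, h3⟩
    exact ReflTransGen.lift (r := TCStep φ' G ν) (p := NumStep K k φ G (decode e f G ν))
      (fun a : (S × (X → Fin K)) × (X × Fin k → G.V) => (a.1.1, decode e a.1.2 G a.2))
      (fun a b hab => ⟨decode_lt he _ hG hab.1, hab.2⟩) _ _ h1
  · rintro ⟨s, y, h1, -, h3⟩
    have key : ∀ z, ReflTransGen (NumStep K k φ G (decode e f G ν))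
        (s₀, fun i => decode e f G ν (g i)) z → ∃ (h : X → Fin K) (x : X × Fin k → G.V),
        decode e h G x = z.2 ∧ (∀ p, G.Reachable (x p)) ∧ ReflTransGen (TCStep φ' G ν)
          ((s₀, fun i => f (g i)), fun p => ν (g p.1, p.2)) ((z.1, h), x) := by
      intro z hz
      induction hz with
      | refl => exact ⟨_, _, rfl, fun _ => hν _, .refl⟩
      | @tail z z' _ hzz ih =>
        obtain ⟨h, x, hx1, hx2, hx3⟩ := ih
        obtain ⟨h', x', hx', hd⟩ := exists_decode he hG hzz.1
        refine ⟨h', x', hd, hx', hx3.tail ⟨hx', ?_⟩⟩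
        have := hzz.2
        rw [← hx1, ← hd] at this
        exact this
    obtain ⟨h, x, hx1, hx2, hx3⟩ := key _ h1
    refine ⟨(s, h), x, hx3, hx2, ?_⟩
    dsimp only at hx1
    rw [← hx1] at h3
    exact h3

/-- Bounded existential quantification. -/
theorem exs (he : Ranked F e) [Finite N] {B : Type} [Finite B]
    {φ : LGraph.{u} d → (B ⊕ N → ℕ) → Prop} (h : NumRecog F e K k (B ⊕ N) φ) :
    NumRecog F e K k N fun G env =>
      ∃ m : B → ℕ, (∀ i, m i < K * G.order ^ k) ∧ φ G (Sum.elim m env) := by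
  intro f
  have h' : ∀ c : B → Fin K, ReachRecog F ((B × Fin k) ⊕ (N × Fin k)) fun G w =>
      φ G (Sum.elim (decode e c G fun p => w (.inl p)) (decode e f G fun p => w (.inr p))) :=
    fun c => by
      refine (ReachRecog.sub (P := (B × Fin k) ⊕ (N × Fin k))
        (fun p : (B ⊕ N) × Fin k => p.1.elim (fun i => .inl (i, p.2)) fun i => .inr (i, p.2))
        (h (Sum.elim c f))).congr fun G _ w _ => Iff.of_eq ?_
      congr 1
      funext i
      rcases i with i | i <;> rfl
  refine (ReachRecog.iEx fun c => ReachRecog.ex (h' c)).congr fun G hG ν hν => ⟨?_, ?_⟩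
  · rintro ⟨c, ξ, h1, h2⟩
    exact ⟨_, decode_lt he c hG h1, h2⟩
  · rintro ⟨m, hm, h⟩
    obtain ⟨c, ξ, h1, rfl⟩ := exists_decode he hG hm
    exact ⟨c, ξ, h1, h⟩

theorem ex (he : Ranked F e) [Finite N] {φ : LGraph.{u} d → ℕ → (N → ℕ) → Prop}
    (h : NumRecog F e K k (Option N) fun G env => φ G (env none) fun i => env (some i)) :
    NumRecog F e K k N fun G env => ∃ m < K * G.order ^ k, φ G m env := by
  refine (exs he (h.sub fun o : Option N => o.elim (.inl ()) .inr)).congr he fun G _ env _ => ?_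
  constructor
  · rintro ⟨m, h1, h2⟩
    exact ⟨m (), h1 (), h2⟩
  · rintro ⟨m, h1, h2⟩
    exact ⟨fun _ => m, fun _ => h1, h2⟩

/-- A predicate without variables. -/
theorem recog {φ : LGraph.{u} d → (Empty → ℕ) → Prop} (h : NumRecog F e K k Empty φ) : Recog F Empty fun G _ => φ G Empty.elim := by
  obtain ⟨ψ, h1, h2⟩ := h Empty.elim
  refine (h1.sub fun p => p.1.elim).congr fun G hG ν => (h2 G hG _ fun p => p.1.elim).trans ?_
  exact Iff.of_eq (congrArg (φ G) (funext fun p => p.elim))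

/-- Numbers that are the numbers of nodes with a recognizable property. -/
theorem nodes (he : Ranked F e) [Finite N] {φ : ∀ G : LGraph.{u} d, (N → G.V) → Prop}
    (h : ReachRecog F N φ) : NumRecog F e K (k + 1) N fun G env =>
      ∃ ν : N → G.V, (∀ i, G.Reachable (ν i)) ∧ (∀ i, env i = e G (ν i)) ∧ φ G ν := by
  intro f
  -- A number is the rank of a node exactly if all digits above the lowest vanish, the leading one
  -- included.
  refine ((ReachRecog.iAll fun i => he.numVal_zero (f i) k fun j => (i, j.succ)).and
    (h.sub fun i => (i, 0))).congr fun G hG ν hν => ?_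
  have hdig : ∀ i, ∀ v : G.V, G.Reachable v → (decode e f G ν i = e G v ↔
      e G (ν (i, 0)) = e G v ∧ numVal (e G) G.order k (f i) (fun j => ν (i, j.succ)) = 0) :=
    fun i v hv => by
      rw [← digits_eq_iff (he.lt_order hG (hν (i, 0))) (he.lt_order hG hv), mul_zero, add_zero]
      rfl
  constructor
  · rintro ⟨h1, h2⟩
    exact ⟨fun i => ν (i, 0), fun i => hν _, fun i => (hdig i _ (hν _)).2 ⟨rfl, h1 i⟩, h2⟩
  · rintro ⟨x, hx, h1, h2⟩
    have h3 := fun i => (hdig i _ (hx i)).1 (h1 i)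
    have h4 : (fun i => ν (i, 0)) = x :=
      funext fun i => (he.bijOn G hG).injOn (hν _) (hx i) (h3 i).1
    exact ⟨fun i => (h3 i).2, by rw [h4]; exact h2⟩

end NumRecog

/-! ### Arithmetic -/

namespace NumRecog

variable {d : ℕ} {F : Set (LGraph.{u} d)} {e : ∀ G : LGraph.{u} d, G.V → ℕ} {K k : ℕ} {N : Type}
  [Finite N]

theorem numeral (he : Ranked F e) (c : ℕ) : ∀ {N : Type} [Finite N] (i : N),
    NumRecog F e K k N fun _ env => env i = c := by
  induction c with
  | zero => exact fun i => zero he i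
  | succ c ih =>
    intro N _ i
    refine (ex he (φ := fun _ m env => m = c ∧ env i = m + 1)
      ((ih none).and (succ he none (some i)))).congr he fun G _ env henv => ?_
    have := henv i
    constructor
    · rintro ⟨m, -, rfl, h⟩
      exact h
    · exact fun h => ⟨c, by omega, rfl, h⟩

/-- If the addition of `c` is recognizable, then so is the addition of multiples of `c`. -/
theorem add_mul (he : Ranked F e) {c : LGraph.{u} d → (N → ℕ) → ℕ}
    (hc : NumRecog F e K k (Fin 2 ⊕ N) fun G env =>
      env (.inl 0) = env (.inl 1) + c G fun i => env (.inr i)) (i w l : N) :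
    NumRecog F e K k N fun G env => env l = env i * c G env + env w := by
  -- Counting down from `(env i, env l)` by `(1, c)` to `(0, env w)`: the intermediate values never
  -- exceed the initial ones and so stay within the bound.
  refine (tc he (X := Fin 2) (S := Unit) ![i, l] ()
    (φ := fun _ _ G env => env (.inl (.inl 0)) = env (.inl (.inr 0)) + 1 ∧
      env (.inl (.inl 1)) = env (.inl (.inr 1)) + c G fun i => env (.inr i))
    (ψ := fun _ _ env => env (.inl 0) = 0 ∧ env (.inl 1) = env (.inr w))
    (fun _ _ => (succ he _ _).and (hc.sub (N := (Fin 2 ⊕ Fin 2) ⊕ N)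
      (Sum.elim (fun j => .inl ((![.inl 1, .inr 1] : Fin 2 → Fin 2 ⊕ Fin 2) j)) .inr)))
    (fun _ => (zero he _).and (eq he _ _))).congr he fun G hG env henv => ⟨?_, ?_⟩
  · rintro ⟨_, y, h1, -, h2, h3⟩
    have key : ∀ z, ReflTransGen (NumStep K k (fun (_ _ : Unit) G (env : (Fin 2 ⊕ Fin 2) ⊕ N → ℕ) =>
        env (.inl (.inl 0)) = env (.inl (.inr 0)) + 1 ∧
        env (.inl (.inl 1)) = env (.inl (.inr 1)) + c G fun i => env (.inr i)) G env)
        ((), fun j => env (![i, l] j)) z →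
        ∃ m, env i = z.2 0 + m ∧ env l = z.2 1 + m * c G env := by
      intro z hz
      induction hz with
      | refl => exact ⟨0, by simp⟩
      | tail _ h ih =>
        obtain ⟨m, hm1, hm2⟩ := ih
        obtain ⟨-, h1, h2⟩ := h
        simp only [Sum.elim_inl, Sum.elim_inr] at h1 h2
        exact ⟨m + 1, by omega, by rw [hm2, h2]; ring⟩
    obtain ⟨m, hm1, hm2⟩ := key _ h1
    simp only [Sum.elim_inl, Sum.elim_inr] at h2 h3 hm1 hm2
    rw [hm2, hm1, h2, h3]
    ring
  · intro h
    have key : ∀ A < K * G.order ^ k, A * c G env + env w < K * G.order ^ k → ∀ x : Fin 2 → ℕ,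
        x 0 = A → x 1 = A * c G env + env w → ReflTransGen
        (NumStep K k (fun (_ _ : Unit) G (env : (Fin 2 ⊕ Fin 2) ⊕ N → ℕ) =>
        env (.inl (.inl 0)) = env (.inl (.inr 0)) + 1 ∧
        env (.inl (.inl 1)) = env (.inl (.inr 1)) + c G fun i => env (.inr i)) G env)
        ((), x) ((), ![0, env w]) := by
      intro A
      induction A with
      | zero =>
        intro _ _ x h0 h1
        rw [show x = ![0, env w] from funext fun j => by fin_cases j <;> simp [h0, h1]]
      | succ A ih =>
        intro hA hB x h0 h1
        have hB' : A * c G env + env w < K * G.order ^ k := by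
          rw [Nat.succ_mul] at hB; omega
        refine .head ⟨fun j => ?_, ?_, ?_⟩
          (ih (by omega) hB' ![A, A * c G env + env w] rfl rfl)
        · fin_cases j
          · exact (Nat.lt_succ_self A).trans hA
          · exact hB'
        · simp [h0]
        · simp only [Sum.elim_inl, Sum.elim_inr, h1]
          simp
          ring
    refine ⟨(), ![0, env w], key (env i) (henv i) (h ▸ henv l) _ rfl h, fun j => ?_, rfl, rfl⟩
    fin_cases j
    · exact (Nat.zero_le _).trans_lt (henv i)
    · exact henv w

theorem add (he : Ranked F e) (i j l : N) : NumRecog F e K k N fun _ env => env l = env i + env j :=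
  (add_mul he (c := fun _ _ => 1) (succ he _ _) i j l).congr he fun _ _ _ _ => by simp

theorem mulAdd (he : Ranked F e) (i j w l : N) :
    NumRecog F e K k N fun _ env => env l = env i * env j + env w :=
  add_mul he (c := fun _ env => env j) (add he _ _ _) i w l

/-- The order is one more than the rank of the last node. -/
theorem order (he : Ranked F e) (i : N) :
    NumRecog F e K (k + 1) N fun G env => env i = G.order := by
  have h : NumRecog F e K (k + 1) (Option N) fun G env => env none + 1 = G.order := by
    refine ((nodes he he.last).sub fun _ => none).congr he fun G hG env _ => ⟨?_, ?_⟩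
    · rintro ⟨ν, -, h1, h2⟩
      exact (congrArg (· + 1) (h1 ())).trans h2
    · intro h
      obtain ⟨v, hv1, hv2⟩ := (he.bijOn G hG).surjOn
        (show env none < G.order by omega)
      exact ⟨fun _ => v, fun _ => hv1, fun _ => hv2.symm, by dsimp only; omega⟩
  refine (ex he (φ := fun G m env => m + 1 = G.order ∧ env i = m + 1)
    (h.and (succ he none (some i)))).congr he fun G hG env henv => ⟨?_, ?_⟩
  · rintro ⟨m, -, h1, h2⟩
    omega
  · intro h
    have h0 : 0 < G.order := (Nat.zero_le _).trans_lt (he.lt_order hG G.reachable_startnode)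
    have := henv i
    exact ⟨G.order - 1, by omega, by omega, by omega⟩

end NumRecog

/-! ### Reading the encoding of a graph -/

theorem getElem?_flatMap_of_length {α β : Type*} {f : α → List β} {m : ℕ} {l : List α}
    (hf : ∀ a, (f a).length = m) {i j : ℕ} (hj : j < m) :
    (l.flatMap f)[i * m + j]? = l[i]?.bind fun a => (f a)[j]? := by
  induction l generalizing i with
  | nil => simp
  | cons a l ih =>
    cases i with
    | zero => simp [List.getElem?_append, hf, hj]
    | succ i =>
      rw [List.flatMap_cons, List.getElem?_append_right (by rw [hf]; nlinarith), hf,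
        show (i + 1) * m + j - m = i * m + j by rw [Nat.succ_mul]; omega, ih]
      simp

namespace SGraph

variable {d : ℕ} (H : SGraph.{u} d) {n : ℕ} (ε : H.V ≃ Fin n)

theorem length_encode : (H.encode ε).length = (n * d + 2) * n := by
  simp [encode]
  ring

theorem getElem?_encode_start (v : Fin n) :
    (H.encode ε)[(v : ℕ)]? = some (decide (ε H.startnode = v)) := by
  simp [encode, List.getElem?_append, v.2]

theorem getElem?_encode_target (v : Fin n) :
    (H.encode ε)[n + v]? = some (decide (H.targetnode.map ε = some v)) := by
  simp [encode, List.getElem?_append, v.2]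

theorem getElem?_encode_edge (u v : Fin n) (a : Fin d) :
    (H.encode ε)[(u * d + a + 2) * n + v]? = some (decide (ε (H.next (ε.symm u) a) = v)) := by
  have h1 : (a : ℕ) * n + v < d * n := by
    have := a.2; have := v.2; nlinarith
  rw [encode, List.getElem?_append_right (by simp; rw [Nat.add_mul]; omega)]
  simp only [List.length_append, List.length_map, List.length_finRange]
  rw [show (u * d + a + 2) * n + v - (n + n) = u * (d * n) + (a * n + v) by
    rw [show (u * d + a + 2) * n + v = u * (d * n) + (a * n + v) + (n + n) by ring]; omega,
    getElem?_flatMap_of_length (by simp) h1]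
  simp [getElem?_flatMap_of_length (f := fun i : Fin d => (List.finRange n).map fun v =>
    decide (ε (H.next (ε.symm u) i) = v)) (l := List.finRange d) (by simp) v.2]

/-- The encoding consists of rows of length `n`. With `p = A * n + v`, row 0 is the start vector,
row 1 the target vector, and row `u * d + a + 2` belongs to the edge labelled `a` from `u`. -/
theorem getElem?_encode_eq_some (p : ℕ) (b : Bool) : (H.encode ε)[p]? = some b ↔
    (∃ v : Fin n, p = v ∧ decide (ε H.startnode = v) = b) ∨
    (∃ v : Fin n, p = n + v ∧ decide (H.targetnode.map ε = some v) = b) ∨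
    ∃ (a : Fin d) (u v : Fin n), p = (u * d + a + 2) * n + v ∧
      decide (ε (H.next (ε.symm u) a) = v) = b := by
  constructor
  · intro h
    have hp := (List.getElem?_eq_some_iff.1 h).1
    rw [length_encode] at hp
    have hn : 0 < n := Nat.pos_of_ne_zero (by rintro rfl; simp at hp)
    have hA : p / n < n * d + 2 := (Nat.div_lt_iff_lt_mul hn).2 hp
    let v : Fin n := ⟨p % n, Nat.mod_lt _ hn⟩
    have hpv : p = p / n * n + v := by rw [mul_comm]; exact (Nat.div_add_mod _ _).symm
    rcases h0 : p / n with _ | _ | A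
    · rw [h0] at hpv
      have hpv : p = v := by simpa using hpv
      rw [hpv, getElem?_encode_start] at h
      exact .inl ⟨v, hpv, by simpa using h⟩
    · rw [h0] at hpv
      have hpv : p = n + v := by simpa using hpv
      rw [hpv, getElem?_encode_target] at h
      exact .inr (.inl ⟨v, hpv, by simpa using h⟩)
    · have hA' : A < n * d := by omega
      have hd : 0 < d := Nat.pos_of_ne_zero (by rintro rfl; simp at hA')
      let u : Fin n := ⟨A / d, (Nat.div_lt_iff_lt_mul hd).2 hA'⟩
      let a : Fin d := ⟨A % d, Nat.mod_lt _ hd⟩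
      have hpv : p = (u * d + a + 2) * n + v := by
        rw [hpv, h0, show u * d + (a : ℕ) = A by rw [mul_comm]; exact Nat.div_add_mod _ _]
      rw [hpv, getElem?_encode_edge] at h
      exact .inr (.inr ⟨a, u, v, hpv, by simpa using h⟩)
  · rintro (⟨v, rfl, rfl⟩ | ⟨v, rfl, rfl⟩ | ⟨a, u, v, rfl, rfl⟩)
    · exact getElem?_encode_start ..
    · exact getElem?_encode_target ..
    · exact getElem?_encode_edge ..

end SGraph

theorem OfflineNTM.readInput_eq_bit {w : List Bool} {p : ℕ} {b : Bool} :
    OfflineNTM.readInput w p = .bit b ↔ ∃ q, p = q + 1 ∧ w[q]? = some b := by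
  cases p with
  | zero => simp [OfflineNTM.readInput]
  | succ q => cases h : w[q]? <;> simp [OfflineNTM.readInput, h]

/-- The bound on `p` is essential: `readInput` returns the right marker at all later cells too. -/
theorem OfflineNTM.readInput_eq_rightEnd {w : List Bool} {p : ℕ} :
    p ≤ w.length + 1 ∧ OfflineNTM.readInput w p = .rightEnd ↔ p = w.length + 1 := by
  cases p with
  | zero => simp [OfflineNTM.readInput]
  | succ q =>
    cases h : w[q]? with
    | none => have := List.getElem?_eq_none_iff.1 h; simp [OfflineNTM.readInput, h]; omega
    | some b =>
      have := (List.getElem?_eq_some_iff.1 h).1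
      simp [OfflineNTM.readInput, h]; omega

theorem OfflineNTM.readInput_eq_leftEnd {w : List Bool} {p : ℕ} :
    OfflineNTM.readInput w p = .leftEnd ↔ p = 0 := by
  cases p with
  | zero => simp [OfflineNTM.readInput]
  | succ q => cases h : w[q]? <;> simp [OfflineNTM.readInput, h]

/-! ### Arithmetic description of the input tape -/

namespace NumRecog

variable {d : ℕ} {F : Set (LGraph.{u} d)} {e : ∀ G : LGraph.{u} d, G.V → ℕ} {K k : ℕ} {N : Type}
  [Finite N]

/-- This is the cell of the right marker. The constants are representable because of `hK`, the other
intermediate values because they do not exceed `env i`. -/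
theorem length_succ (he : Ranked F e) (hK : d + 2 < K) (i : N) :
    NumRecog F e K (k + 1) N fun G env => env i = (G.order * d + 2) * G.order + 1 := by
  refine (exs he (B := Fin 6) (φ := fun G env => env (.inl 0) = G.order ∧ env (.inl 1) = d ∧
    env (.inl 2) = 2 ∧ env (.inl 3) = env (.inl 0) * env (.inl 1) + env (.inl 2) ∧
    env (.inl 4) = 0 ∧ env (.inl 5) = env (.inl 3) * env (.inl 0) + env (.inl 4) ∧
    env (.inr i) = env (.inl 5) + 1)
    ((order he _).and ((numeral he d _).and ((numeral he 2 _).and ((mulAdd he _ _ _ _).and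
      ((zero he _).and ((mulAdd he _ _ _ _).and (succ he _ _)))))))).congr he
    fun G hG env henv => ⟨?_, ?_⟩
  · rintro ⟨m, -, h⟩
    simp only [Sum.elim_inl, Sum.elim_inr] at h
    obtain ⟨h0, h1, h2, h3, h4, h5, h6⟩ := h
    rw [h6, h5, h4, h3, h2, h1, h0, add_zero]
  · intro h
    have h0 : 0 < G.order := (Nat.zero_le _).trans_lt (he.lt_order hG G.reachable_startnode)
    have hi := henv i
    have hKb : K ≤ K * G.order ^ (k + 1) := Nat.le_mul_of_pos_right _ (pow_pos h0 _)
    have h1 : G.order * d + 2 ≤ (G.order * d + 2) * G.order := Nat.le_mul_of_pos_right _ h0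
    have h2 : G.order ≤ (G.order * d + 2) * G.order := Nat.le_mul_of_pos_left _ (by omega)
    refine ⟨![G.order, d, 2, G.order * d + 2, 0, (G.order * d + 2) * G.order], fun j => ?_,
      rfl, rfl, rfl, rfl, rfl, rfl, h⟩
    generalize K * G.order ^ (k + 1) = bd at *
    fin_cases j <;> simp <;> omega

/-- Both values of `b` are treated together because negation is not available. The summand 1
accounts for the left marker in cell 0. -/
theorem startBit (he : Ranked F e) (b : Bool) (i : N) :
    NumRecog F e K (k + 1) N fun G env => ∃ x, G.Reachable x ∧ (b = true ↔ G.startnode = x) ∧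
      env i = e G x + 1 := by
  refine (ex he (φ := fun G m env => (∃ ν : Unit → G.V, (∀ i, G.Reachable (ν i)) ∧
    (∀ i, m = e G (ν i)) ∧ (b = true ↔ G.startnode = ν ())) ∧ env i = m + 1)
    (((nodes he (ReachRecog.start () b)).sub fun _ => none).and (succ he _ _))).congr he
    fun G hG env henv => ⟨?_, ?_⟩
  · rintro ⟨m, -, ⟨ν, h1, h2, h3⟩, h4⟩
    exact ⟨ν (), h1 (), h3, by rw [h4, h2 ()]⟩
  · rintro ⟨x, h1, h2, h3⟩
    have := henv i
    exact ⟨e G x, by omega, ⟨fun _ => x, fun _ => h1, fun _ => rfl, h2⟩, h3⟩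

/-- If the target is unreachable, no reachable `x` equals it and only `b = false` is possible, as in
the all-zero vector. Reachability of the target need not be decided. -/
theorem targetBit (he : Ranked F e) (b : Bool) (i : N) :
    NumRecog F e K (k + 1) N fun G env => ∃ x, G.Reachable x ∧ (b = true ↔ G.targetnode = x) ∧
      env i = G.order + e G x + 1 := by
  refine (exs he (B := Fin 3) (φ := fun G env => (∃ ν : Unit → G.V, (∀ i, G.Reachable (ν i)) ∧
    (∀ i, env (.inl 0) = e G (ν i)) ∧ (b = true ↔ G.targetnode = ν ())) ∧
    env (.inl 1) = G.order ∧ env (.inl 2) = env (.inl 1) + env (.inl 0) ∧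
    env (.inr i) = env (.inl 2) + 1)
    (((nodes he (ReachRecog.target () b)).sub (N := Fin 3 ⊕ N) fun _ => .inl 0).and ((order he _).and
      ((add he _ _ _).and (succ he _ _))))).congr he fun G hG env henv => ⟨?_, ?_⟩
  · rintro ⟨m, -, h⟩
    simp only [Sum.elim_inl, Sum.elim_inr] at h
    obtain ⟨⟨ν, h1, h2, h3⟩, h4, h5, h6⟩ := h
    exact ⟨ν (), h1 (), h3, by rw [h6, h5, h4, h2 ()]⟩
  · rintro ⟨x, h1, h2, h3⟩
    have := henv i
    refine ⟨![e G x, G.order, G.order + e G x], fun j => ?_,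
      ⟨fun _ => x, fun _ => h1, fun _ => rfl, h2⟩, rfl, rfl, h3⟩
    generalize K * G.order ^ (k + 1) = bd at *
    fin_cases j <;> simp <;> omega

theorem edgeBit (he : Ranked F e) (hK : d + 2 < K) (b : Bool) (a : Fin d) (i : N) :
    NumRecog F e K (k + 1) N fun G env => ∃ x y, G.Reachable x ∧ G.Reachable y ∧
      (b = true ↔ G.next x a = y) ∧ env i = (e G x * d + a + 2) * G.order + e G y + 1 := by
  refine (exs he (B := Fin 7) (φ := fun G env => (∃ ν : Fin 2 → G.V, (∀ i, G.Reachable (ν i)) ∧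
    (∀ j, env (.inl (![0, 1] j)) = e G (ν j)) ∧ (b = true ↔ G.next (ν 0) a = ν 1)) ∧
    env (.inl 2) = d ∧ env (.inl 3) = a + 2 ∧
    env (.inl 4) = env (.inl 0) * env (.inl 2) + env (.inl 3) ∧ env (.inl 5) = G.order ∧
    env (.inl 6) = env (.inl 4) * env (.inl 5) + env (.inl 1) ∧ env (.inr i) = env (.inl 6) + 1)
    (((nodes he (ReachRecog.edge (P := Fin 2) a 0 1 b)).sub (N := Fin 7 ⊕ N)
      fun j => .inl (![0, 1] j)).and
      ((numeral he d _).and ((numeral he (a + 2) _).and ((mulAdd he _ _ _ _).and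
        ((order he _).and ((mulAdd he _ _ _ _).and (succ he _ _)))))))).congr he
    fun G hG env henv => ⟨?_, ?_⟩
  · rintro ⟨m, -, h⟩
    simp only [Sum.elim_inl, Sum.elim_inr] at h
    obtain ⟨⟨ν, h1, h2, h3⟩, h4, h5, h6, h7, h8, h9⟩ := h
    refine ⟨ν 0, ν 1, h1 0, h1 1, h3, ?_⟩
    have h20 := h2 0
    have h21 := h2 1
    simp only [Matrix.cons_val_zero, Matrix.cons_val_one] at h20 h21
    rw [h9, h8, h7, h6, h5, h4, h20, h21, ← add_assoc]
  · rintro ⟨x, y, hx, hy, h2, h3⟩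
    have h0 : 0 < G.order := (Nat.zero_le _).trans_lt (he.lt_order hG G.reachable_startnode)
    have hi := henv i
    have hKb : K ≤ K * G.order ^ (k + 1) := Nat.le_mul_of_pos_right _ (pow_pos h0 _)
    have hxl := he.lt_order hG hx
    have hyl := he.lt_order hG hy
    have h4 : G.order ≤ (e G x * d + a + 2) * G.order := Nat.le_mul_of_pos_left _ (by omega)
    have h5 : e G x * d + a + 2 ≤ (e G x * d + a + 2) * G.order := Nat.le_mul_of_pos_right _ h0
    have ha := a.2
    refine ⟨![e G x, e G y, d, a + 2, e G x * d + (a + 2), G.order,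
      (e G x * d + (a + 2)) * G.order + e G y], fun j => ?_, ⟨![x, y], fun j => ?_, fun j => ?_, h2⟩,
      rfl, rfl, rfl, rfl, rfl, ?_⟩
    · simp only [add_assoc] at h3 h5 h4
      generalize K * G.order ^ (k + 1) = bd at *
      fin_cases j <;> simp <;> omega
    · fin_cases j <;> assumption
    · fin_cases j <;> rfl
    · simpa [add_assoc] using h3

/-- The symbols of the encoding along an accessible numbering can be read by an automaton. -/
theorem read (he : Ranked F e) (hK : d + 2 < K) {w : LGraph.{u} d → List Bool}
    (hw : ∀ G ∈ F, ∃ ε : G.reachablePart.V ≃ Fin G.order, (∀ v, (ε v : ℕ) = e G v.1) ∧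
      w G = G.reachablePart.encode ε) (i : N) (σ : InputSym) :
    NumRecog F e K (k + 1) N fun G env => env i ≤ (w G).length + 1 ∧
      OfflineNTM.readInput (w G) (env i) = σ := by
  cases σ with
  | leftEnd =>
    refine (zero he i).congr he fun G _ env _ => ?_
    rw [OfflineNTM.readInput_eq_leftEnd]
    omega
  | rightEnd =>
    refine (length_succ he hK i).congr he fun G hG env _ => ?_
    obtain ⟨ε, -, h⟩ := hw G hG
    rw [OfflineNTM.readInput_eq_rightEnd, h, SGraph.length_encode]
  | bit b =>
    refine ((startBit he b i).or ((targetBit he b i).or (iEx fun a => edgeBit he hK b a i))).congr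
      he fun G hG env _ => ?_
    obtain ⟨ε, hε, h⟩ := hw G hG
    have hb : ∀ p : Prop, [Decidable p] → (decide p = b ↔ (b = true ↔ p)) := fun p _ => by
      by_cases hp : p <;> cases b <;> simp [hp]
    have ht : ∀ v : G.reachablePart.V, G.reachablePart.targetnode.map ε = some (ε v) ↔
        G.targetnode = v.1 := fun v => by
      by_cases hr : G.Reachable G.targetnode
      · rw [show G.reachablePart.targetnode = some ⟨_, hr⟩ from dif_pos hr]
        exact (Option.some_inj.trans ε.apply_eq_iff_eq).trans Subtype.ext_iff
      · rw [show G.reachablePart.targetnode = none from dif_neg hr]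
        simp only [Option.map_none, reduceCtorEq, false_iff]
        intro h
        exact hr (h ▸ v.2)
    have hs : ∀ v : G.reachablePart.V, ε G.reachablePart.startnode = ε v ↔
        G.startnode = v.1 := fun v => by
      rw [EmbeddingLike.apply_eq_iff_eq]
      exact Subtype.ext_iff
    have hn : ∀ (a : Fin d) (x y : G.reachablePart.V),
        ε (G.reachablePart.next (ε.symm (ε x)) a) = ε y ↔ G.next x.1 a = y.1 := fun a x y => by
      rw [EmbeddingLike.apply_eq_iff_eq, ε.symm_apply_apply]
      exact Subtype.ext_iff
    have hlen : OfflineNTM.readInput (w G) (env i) = .bit b → env i ≤ (w G).length + 1 := by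
      rw [OfflineNTM.readInput_eq_bit]
      rintro ⟨q, h1, h2⟩
      have := (List.getElem?_eq_some_iff.1 h2).1
      omega
    rw [and_iff_right_of_imp hlen, OfflineNTM.readInput_eq_bit, h]
    -- Vertex numbers are replaced by the reachable nodes that carry them, via the bijection `ε`.
    simp only [SGraph.getElem?_encode_eq_some, hb, ← ε.exists_congr_right (q := fun v => _), hε,
      hs, ht, hn]
    constructor
    · rintro (⟨x, h1, h2, h3⟩ | ⟨x, h1, h2, h3⟩ | ⟨a, x, y, h1, h2, h3, h4⟩)
      · exact ⟨_, h3, .inl ⟨⟨x, h1⟩, rfl, h2⟩⟩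
      · exact ⟨_, h3, .inr (.inl ⟨⟨x, h1⟩, rfl, h2⟩)⟩
      · exact ⟨_, h4, .inr (.inr ⟨a, ⟨x, h1⟩, ⟨y, h2⟩, rfl, h3⟩)⟩
    · rintro ⟨q, h1, ⟨x, rfl, h2⟩ | ⟨x, rfl, h2⟩ | ⟨a, x, y, rfl, h2⟩⟩
      · exact .inl ⟨x.1, x.2, h2, h1⟩
      · exact .inr (.inl ⟨x.1, x.2, h2, h1⟩)
      · exact .inr (.inr ⟨a, x.1, y.1, x.2, y.2, h2, h1⟩)

end NumRecog

/-! ### Simulation of Turing machines on numbers -/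

instance InputSym.instFinite : Finite InputSym :=
  Finite.of_surjective (fun o : Option (Option Bool) =>
    o.elim InputSym.leftEnd fun o => o.elim InputSym.rightEnd InputSym.bit) fun σ => by
    cases σ with
    | leftEnd => exact ⟨none, rfl⟩
    | rightEnd => exact ⟨some none, rfl⟩
    | bit b => exact ⟨some (some b), rfl⟩

instance Shift.instFinite : Finite Shift :=
  Finite.of_surjective (fun o : Option Bool =>
    o.elim Shift.stay fun b => if b then Shift.left else Shift.right) fun m => by
    cases m with
    | left => exact ⟨some true, rfl⟩
    | stay => exact ⟨none, rfl⟩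
    | right => exact ⟨some false, rfl⟩

/-- The digits `τ 0, …, τ (p - 1)` in base `g`, the last one being the least significant. -/
def leftCode (g : ℕ) (τ : ℕ → ℕ) : ℕ → ℕ
  | 0 => 0
  | p + 1 => leftCode g τ p * g + τ p

/-- The digits `τ p, …, τ (p + m - 1)` in base `g`, the first one being the least significant. -/
def rightCode (g : ℕ) (τ : ℕ → ℕ) : ℕ → ℕ → ℕ
  | 0, _ => 0
  | m + 1, p => rightCode g τ m (p + 1) * g + τ p

section codes

variable {g : ℕ} {τ τ' : ℕ → ℕ}

theorem mul_add_lt_mul {a b c : ℕ} (ha : a < c) (hb : b < g) : a * g + b < c * g := by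
  calc a * g + b < a * g + g := by omega
    _ = (a + 1) * g := by ring
    _ ≤ c * g := Nat.mul_le_mul_right _ ha

theorem mul_add_eq_iff {a b c c' : ℕ} (hc : c < g) (hc' : c' < g) :
    a * g + c = b * g + c' ↔ a = b ∧ c = c' := by
  rw [add_comm, mul_comm a, add_comm (b * g), mul_comm b, digits_eq_iff hc hc', and_comm]

theorem leftCode_lt (hτ : ∀ i, τ i < g) : ∀ p, leftCode g τ p < g ^ p
  | 0 => by simp [leftCode]
  | p + 1 => by
    rw [pow_succ]
    exact mul_add_lt_mul (leftCode_lt hτ p) (hτ p)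

theorem rightCode_lt (hτ : ∀ i, τ i < g) : ∀ m p, rightCode g τ m p < g ^ m
  | 0, _ => by simp [rightCode]
  | m + 1, p => by
    rw [pow_succ]
    exact mul_add_lt_mul (rightCode_lt hτ m (p + 1)) (hτ p)

theorem leftCode_congr : ∀ {p : ℕ}, (∀ i < p, τ i = τ' i) → leftCode g τ p = leftCode g τ' p
  | 0, _ => rfl
  | p + 1, h => by
    rw [leftCode, leftCode, leftCode_congr fun i hi => h i (by omega), h p (by omega)]

theorem rightCode_congr : ∀ {m p : ℕ}, (∀ i, p ≤ i → τ i = τ' i) →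
    rightCode g τ m p = rightCode g τ' m p
  | 0, _, _ => rfl
  | m + 1, p, h => by
    rw [rightCode, rightCode, rightCode_congr fun i hi => h i (by omega), h p le_rfl]

theorem rightCode_zero : ∀ m p : ℕ, rightCode g (fun _ => 0) m p = 0
  | 0, _ => rfl
  | m + 1, p => by simp [rightCode, rightCode_zero m]

end codes

/-- The movement of the input head from `p` to `p'`, when the symbol `σ` is read. -/
def InMove : Shift → InputSym → ℕ → ℕ → Prop
  | .stay, _, p, p' => p' = p
  | .right, .rightEnd, p, p' => p' = p
  | .right, _, p, p' => p' = p + 1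
  | .left, _, p, p' => (p = 0 ∧ p' = 0) ∨ p = p' + 1

/-- Within the tape, the symbol read tells whether the head is at the right end, so the truncation
by `min` becomes a case distinction that needs only zero, equality and successor. -/
theorem inMove_iff {m : Shift} {σ : InputSym} {w : List Bool} {p p' : ℕ} (hp : p ≤ w.length + 1)
    (hσ : OfflineNTM.readInput w p = σ) :
    InMove m σ p p' ↔ p' = min (m.apply p) (w.length + 1) := by
  have hr : OfflineNTM.readInput w p = .rightEnd ↔ p = w.length + 1 := by
    rw [← OfflineNTM.readInput_eq_rightEnd, and_iff_right hp]
  rw [hσ] at hr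
  cases m with
  | stay => simp only [InMove, Shift.apply, min_eq_left hp]
  | left => simp only [InMove, Shift.apply]; omega
  | right =>
    cases σ with
    | rightEnd =>
      have := hr.1 rfl
      simp only [InMove, Shift.apply]
      omega
    | leftEnd =>
      have : p ≠ w.length + 1 := fun h => by simpa using hr.2 h
      simp only [InMove, Shift.apply]
      omega
    | bit b =>
      have : p ≠ w.length + 1 := fun h => by simpa using hr.2 h
      simp only [InMove, Shift.apply]
      omega

/-- The change of the head position `q` and of the two halves `L` and `R` of the work tape, when
the symbol `c` is replaced by `a`. -/
def WorkMove (g c a : ℕ) : Shift → ℕ → ℕ → ℕ → ℕ → ℕ → ℕ → Prop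
  | .stay, q, L, R, q', L', R' => q' = q ∧ L' = L ∧ ∃ r ≤ R, R = r * g + c ∧ R' = r * g + a
  | .right, q, L, R, q', L', R' => q' = q + 1 ∧ L' = L * g + a ∧ R = R' * g + c
  | .left, q, L, R, q', L', R' =>
    (q = 0 ∧ q' = 0 ∧ L' = L ∧ ∃ r ≤ R, R = r * g + c ∧ R' = r * g + a) ∨
    (q = q' + 1 ∧ ∃ b : Fin g, L = L' * g + b ∧ ∃ r ≤ R, R = r * g + c ∧ ∃ t ≤ R', t = r * g + a ∧
      R' = t * g + b)

section workMove

variable {g c a : ℕ} {τ : ℕ → ℕ} {m : Shift} {s q q' L' R' : ℕ}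

/-- The scanned cell is the lowest digit of the right half, and each kind of move exhibits `c` as
that digit. -/
theorem eq_of_workMove (hτ : ∀ i, τ i < g) (hc : c < g) (hq : q ≤ s)
    (h : WorkMove g c a m q (leftCode g τ q) (rightCode g τ (s + 1 - q) q) q' L' R') : c = τ q := by
  have key : ∀ r, rightCode g τ (s + 1 - q) q = r * g + c → c = τ q := fun r hr => by
    rw [show s + 1 - q = (s - q) + 1 by omega, rightCode, mul_add_eq_iff (hτ _) hc] at hr
    exact hr.2.symm
  cases m with
  | stay => obtain ⟨-, -, r, -, hr, -⟩ := h; exact key r hr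
  | right => exact key _ h.2.2
  | left =>
    rcases h with ⟨-, -, -, r, -, hr, -⟩ | ⟨-, b, -, r, -, hr, -⟩ <;> exact key r hr

/-- The halves act as two stacks with the scanned symbol on top of the right one. Moving right pops
it and pushes `a` on the left stack; moving left replaces it by `a` and transfers the top of the
left stack. Uniqueness of division by `g` fixes all witnesses. -/
theorem workMove_iff (hg : 0 < g) (hτ : ∀ i, τ i < g) (hq : q ≤ s) (hm : m.apply q ≤ s) :
    WorkMove g (τ q) a m q (leftCode g τ q) (rightCode g τ (s + 1 - q) q) q' L' R' ↔
      q' = m.apply q ∧ L' = leftCode g (Function.update τ q a) (m.apply q) ∧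
      R' = rightCode g (Function.update τ q a) (s + 1 - m.apply q) (m.apply q) := by
  have hR : rightCode g τ (s + 1 - q) q = rightCode g τ (s - q) (q + 1) * g + τ q := by
    rw [show s + 1 - q = (s - q) + 1 by omega, rightCode]
  have hR' : rightCode g (Function.update τ q a) (s + 1 - q) q =
      rightCode g τ (s - q) (q + 1) * g + a := by
    rw [show s + 1 - q = (s - q) + 1 by omega, rightCode, Function.update_self]
    congr 2
    exact rightCode_congr fun i hi => by rw [Function.update_of_ne (by omega)]
  have hL : ∀ p ≤ q, leftCode g (Function.update τ q a) p = leftCode g τ p := fun p hp =>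
    leftCode_congr fun i hi => by rw [Function.update_of_ne (by omega)]
  have hr : ∀ Φ : ℕ → Prop, (∃ r ≤ rightCode g τ (s - q) (q + 1) * g + τ q,
      rightCode g τ (s - q) (q + 1) * g + τ q = r * g + τ q ∧ Φ r) ↔
      Φ (rightCode g τ (s - q) (q + 1)) := fun Φ => by
    constructor
    · rintro ⟨r, -, h1, h2⟩
      rw [mul_add_eq_iff (hτ q) (hτ q)] at h1
      rw [h1.1]; exact h2
    · exact fun h => ⟨_, (Nat.le_mul_of_pos_right _ hg).trans (Nat.le_add_right _ _), rfl, h⟩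
  cases m with
  | stay => simp only [WorkMove, Shift.apply, hR, hR', hL q le_rfl, hr]
  | right =>
    simp only [WorkMove, Shift.apply, hR, mul_add_eq_iff (hτ q) (hτ q), and_true, leftCode,
      Function.update_self, hL q le_rfl]
    rw [show s + 1 - (q + 1) = s - q by omega,
      rightCode_congr (τ := Function.update τ q a) (τ' := τ) fun i hi => by
        rw [Function.update_of_ne (by omega)]]
    exact and_congr_right fun _ => and_congr_right fun _ => eq_comm
  | left =>
    cases q with
    | zero =>
      simp only [WorkMove, Shift.apply, hR, hR', hL 0 le_rfl, hr]
      simp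
    | succ q =>
      simp only [WorkMove, Shift.apply, hR, hr, Nat.add_sub_cancel, hL q (Nat.le_succ q)]
      rw [show s + 1 - q = (s + 1 - (q + 1)) + 1 by omega, rightCode, hR',
        Function.update_of_ne (by omega), leftCode]
      constructor
      · rintro (⟨h, -⟩ | ⟨h1, b, h2, t, -, h3, h4⟩)
        · omega
        · rw [mul_add_eq_iff (hτ q) b.2] at h2
          refine ⟨by omega, h2.1.symm, ?_⟩
          rw [h4, h3, h2.2]
      · rintro ⟨rfl, rfl, rfl⟩
        exact .inr ⟨rfl, ⟨τ q', hτ q'⟩, rfl, _,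
          (Nat.le_mul_of_pos_right _ hg).trans (Nat.le_add_right _ _), rfl, rfl⟩

end workMove

namespace OfflineNTM

variable (M : OfflineNTM) (enc : M.Γ → ℕ) (g s : ℕ)

/-- The numbers that represent a configuration. -/
def Cfg.code {M : OfflineNTM} (enc : M.Γ → ℕ) (g s : ℕ) (x : M.Cfg) : Fin 4 → ℕ :=
  ![x.inPos, x.workPos, leftCode g (enc ∘ x.work) x.workPos,
    rightCode g (enc ∘ x.work) (s + 1 - x.workPos) x.workPos]

/-- One step of `M`, on codes. -/
def CodeStep (w : List Bool) (k k' : M.K) (x y : Fin 4 → ℕ) : Prop :=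
  ∃ z : InputSym × M.Γ × M.Γ × Shift × Shift, (k', z.2.2.1, z.2.2.2.1, z.2.2.2.2) ∈ M.δ k z.1 z.2.1 ∧
    (x 0 ≤ w.length + 1 ∧ readInput w (x 0) = z.1) ∧ InMove z.2.2.2.1 z.1 (x 0) (y 0) ∧
    WorkMove g (enc z.2.1) (enc z.2.2.1) z.2.2.2.2 (x 1) (x 2) (x 3) (y 1) (y 2) (y 3)

variable {M enc g s} {w : List Bool}

theorem inPos_le {x : M.Cfg} (h : M.ReachableCfg w x) : x.inPos ≤ w.length + 1 := by
  cases h with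
  | refl => exact Nat.zero_le _
  | tail _ h =>
    obtain ⟨k, a, m, m', -, rfl⟩ := h
    exact min_le_right _ _

/-- The guessed symbol is forced to be the scanned one by `eq_of_workMove` and injectivity of `enc`.
The successor is again reachable, so its head also obeys the bound `s` needed for `workMove_iff`. -/
theorem codeStep_iff (hinj : enc.Injective) (hg : ∀ c, enc c < g)
    (hs : ∀ x, M.ReachableCfg w x → x.workPos ≤ s) {x : M.Cfg} (hx : M.ReachableCfg w x) {k' : M.K}
    {y : Fin 4 → ℕ} : M.CodeStep enc g w x.state k' (x.code enc g s) y ↔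
      ∃ x', M.Step w x x' ∧ x'.state = k' ∧ x'.code enc g s = y := by
  have hg0 : 0 < g := (Nat.zero_le _).trans_lt (hg M.blank)
  have hup : ∀ a, enc ∘ Function.update x.work x.workPos a =
      Function.update (enc ∘ x.work) x.workPos (enc a) := fun a => Function.comp_update _ _ _ _
  constructor
  · rintro ⟨⟨σ, c, a, m, m'⟩, hδ, ⟨h1, h2⟩, h3, h4⟩
    simp only [Cfg.code, Matrix.cons_val] at h1 h2 h3 h4 hδ
    obtain rfl : c = x.work x.workPos :=
      hinj (eq_of_workMove (τ := enc ∘ x.work) (fun _ => hg _) (hg c) (hs x hx) h4)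
    subst h2
    have hstep : M.Step w x ⟨k', min (m.apply x.inPos) (w.length + 1), m'.apply x.workPos,
        Function.update x.work x.workPos a⟩ := ⟨k', a, m, m', hδ, rfl⟩
    have hw := (workMove_iff (τ := enc ∘ x.work) hg0 (fun _ => hg _) (hs x hx)
      (hs _ (hx.tail hstep))).1 h4
    refine ⟨_, hstep, rfl, funext fun i => ?_⟩
    rw [inMove_iff h1 rfl] at h3
    obtain ⟨h5, h6, h7⟩ := hw
    fin_cases i
    · exact h3.symm
    · exact h5.symm
    · simp only [Cfg.code, hup]; exact h6.symm
    · simp only [Cfg.code, hup]; exact h7.symm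
  · rintro ⟨x', hstep, rfl, rfl⟩
    have hx' := hs _ (hx.tail hstep)
    obtain ⟨k, a, m, m', hδ, rfl⟩ := hstep
    refine ⟨(_, _, a, m, m'), hδ, ⟨inPos_le hx, rfl⟩, (inMove_iff (inPos_le hx) rfl).2 rfl, ?_⟩
    refine (workMove_iff (τ := enc ∘ x.work) hg0 (fun _ => hg _) (hs x hx) hx').2 ⟨rfl, ?_, ?_⟩
    · simp only [Cfg.code, hup]; rfl
    · simp only [Cfg.code, hup]; rfl

theorem code_lt (hg2 : 2 ≤ g) (hg : ∀ c, enc c < g)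
    (hs : ∀ x, M.ReachableCfg w x → x.workPos ≤ s) {x : M.Cfg} (hx : M.ReachableCfg w x) {B : ℕ}
    (h1 : w.length + 1 < B) (h2 : g ^ (s + 1) ≤ B) (i : Fin 4) : x.code enc g s i < B := by
  have h3 := hs x hx
  fin_cases i
  · exact (inPos_le hx).trans_lt h1
  · have : s + 1 < g ^ (s + 1) := Nat.lt_pow_self hg2
    exact lt_of_lt_of_le (show x.workPos < g ^ (s + 1) by omega) h2
  · exact (leftCode_lt (fun _ => hg _) _).trans_le
      ((Nat.pow_le_pow_right (by omega) (by omega)).trans h2)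
  · exact (rightCode_lt (fun _ => hg _) _ _).trans_le
      ((Nat.pow_le_pow_right (by omega) (by omega)).trans h2)

end OfflineNTM

/-- Logarithmically many digits make a polynomially bounded number. -/
theorem pow_log_le (g c d n : ℕ) (hn : 0 < n) :
    g ^ (c * (Nat.log 2 ((n * d + 2) * n) + 1) + 1) ≤
      g ^ (c + 1) * (d + 2) ^ (g * c) * n ^ (2 * (g * c) + 2) := by
  have h1 : (n * d + 2) * n ≤ (d + 2) * n ^ 2 := by nlinarith
  -- The crude estimate `g ≤ 2 ^ g` suffices to turn the power of a logarithm into a polynomial.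
  have h2 : g ^ Nat.log 2 ((n * d + 2) * n) ≤ ((d + 2) * n ^ 2) ^ g := by
    calc g ^ Nat.log 2 ((n * d + 2) * n) ≤ (2 ^ g) ^ Nat.log 2 ((n * d + 2) * n) :=
          Nat.pow_le_pow_left Nat.lt_two_pow_self.le _
      _ = (2 ^ Nat.log 2 ((n * d + 2) * n)) ^ g := by rw [← pow_mul, ← pow_mul, mul_comm]
      _ ≤ ((n * d + 2) * n) ^ g := Nat.pow_le_pow_left (Nat.pow_log_le_self 2 (by positivity)) _
      _ ≤ ((d + 2) * n ^ 2) ^ g := Nat.pow_le_pow_left h1 _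
  calc g ^ (c * (Nat.log 2 ((n * d + 2) * n) + 1) + 1)
      = g ^ (c + 1) * (g ^ Nat.log 2 ((n * d + 2) * n)) ^ c := by ring
    _ ≤ g ^ (c + 1) * (((d + 2) * n ^ 2) ^ g) ^ c :=
        Nat.mul_le_mul_left _ (Nat.pow_le_pow_left h2 _)
    _ = g ^ (c + 1) * (d + 2) ^ (g * c) * n ^ (2 * (g * c)) := by
        rw [← pow_mul, mul_pow, ← pow_mul, mul_assoc]
    _ ≤ g ^ (c + 1) * (d + 2) ^ (g * c) * n ^ (2 * (g * c) + 2) :=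
        Nat.mul_le_mul_left _ (Nat.pow_le_pow_right hn (by omega))

namespace NumRecog

variable {d : ℕ} {F : Set (LGraph.{u} d)} {e : ∀ G : LGraph.{u} d, G.V → ℕ} {K k : ℕ} {N : Type}
  [Finite N]

theorem affine (he : Ranked F e) {g c : ℕ} (hg : g < K) (hc : c < K) (r l : N) :
    NumRecog F e K k N fun _ env => env l = env r * g + c := by
  refine (exs he (B := Fin 2) (φ := fun G env => env (.inl 0) = g ∧ env (.inl 1) = c ∧
    env (.inr l) = env (.inr r) * env (.inl 0) + env (.inl 1))
    ((numeral he g _).and ((numeral he c _).and (mulAdd he _ _ _ _)))).congr he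
    fun G hG env henv => ⟨?_, ?_⟩
  · rintro ⟨m, -, h⟩
    simp only [Sum.elim_inl, Sum.elim_inr] at h
    obtain ⟨h1, h2, h3⟩ := h
    rw [h3, h1, h2]
  · intro h
    have h0 : 0 < G.order := (Nat.zero_le _).trans_lt (he.lt_order hG G.reachable_startnode)
    have hKb : K ≤ K * G.order ^ k := Nat.le_mul_of_pos_right _ (pow_pos h0 _)
    refine ⟨![g, c], fun j => ?_, rfl, rfl, h⟩
    fin_cases j
    · exact hg.trans_le hKb
    · exact hc.trans_le hKb

/-- Existential quantification with a bound that is the value of a variable. -/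
theorem exLe (he : Ranked F e) {φ : LGraph.{u} d → ℕ → (N → ℕ) → Prop} (i : N)
    (h : NumRecog F e K k (Option N) fun G env => φ G (env none) fun i => env (some i)) :
    NumRecog F e K k N fun G env => ∃ m ≤ env i, φ G m env := by
  have hle : NumRecog F e K k (Option N) fun _ env => env none ≤ env (some i) := by
    refine (ex he (φ := fun _ m env => env (some i) = env none + m) (add he _ _ _)).congr he
      fun G hG env henv => ⟨?_, fun h => ?_⟩
    · rintro ⟨m, -, h⟩
      omega
    · have := henv (some i)
      exact ⟨env (some i) - env none, by omega, by omega⟩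
  refine (ex he (φ := fun G m env => m ≤ env i ∧ φ G m env) (hle.and h)).congr he
    fun G hG env henv => ⟨?_, ?_⟩
  · rintro ⟨m, -, h⟩
    exact ⟨m, h⟩
  · rintro ⟨m, h⟩
    exact ⟨m, h.1.trans_lt (henv i), h⟩

theorem inMove (he : Ranked F e) (m : Shift) (σ : InputSym) (i j : N) :
    NumRecog F e K k N fun _ env => InMove m σ (env i) (env j) := by
  cases m with
  | stay => exact eq he _ _
  | left => exact ((zero he _).and (zero he _)).or (succ he _ _)
  | right =>
    cases σ with
    | leftEnd => exact succ he _ _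
    | rightEnd => exact eq he _ _
    | bit b => exact succ he _ _

theorem workMove (he : Ranked F e) {g c a : ℕ} (hg : g < K) (hc : c < K) (ha : a < K) (m : Shift)
    (q L R q' L' R' : N) : NumRecog F e K k N fun _ env =>
      WorkMove g c a m (env q) (env L) (env R) (env q') (env L') (env R') := by
  have hstay : NumRecog F e K k N fun _ env =>
      ∃ r ≤ env R, env R = r * g + c ∧ env R' = r * g + a :=
    exLe he (φ := fun _ r env => env R = r * g + c ∧ env R' = r * g + a) R
      ((affine he hg hc _ _).and (affine he hg ha _ _))
  cases m with
  | stay => exact (eq he _ _).and ((eq he _ _).and hstay)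
  | right => exact (succ he _ _).and ((affine he hg ha _ _).and (affine he hg hc _ _))
  | left =>
    have hleft : ∀ b : Fin g, NumRecog F e K k N fun _ env => env L = env L' * g + b ∧
        ∃ r ≤ env R, env R = r * g + c ∧ ∃ t ≤ env R', t = r * g + a ∧ env R' = t * g + b :=
      fun b => (affine he hg (b.2.trans hg) _ _).and
        (exLe he (φ := fun _ r env => env R = r * g + c ∧
            ∃ t ≤ env R', t = r * g + a ∧ env R' = t * g + b) R
          ((affine he hg hc _ _).and
            (exLe he (φ := fun _ t env => t = env none * g + a ∧ env (some R') = t * g + b) (some R')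
              ((affine he hg ha (some none) none).and
                (affine he hg (b.2.trans hg) none (some (some R')))))))
    exact ((zero he _).and ((zero he _).and ((eq he _ _).and hstay))).or
      ((succ he _ _).and (iEx hleft))

open OfflineNTM in
theorem codeStep (he : Ranked F e) (hK : d + 2 < K) {w : LGraph.{u} d → List Bool}
    (hw : ∀ G ∈ F, ∃ ε : G.reachablePart.V ≃ Fin G.order, (∀ v, (ε v : ℕ) = e G v.1) ∧
      w G = G.reachablePart.encode ε) (M : OfflineNTM) {enc : M.Γ → ℕ} {g : ℕ} (hg : g < K)
    (henc : ∀ c, enc c < g) (q q' : M.K) (x y : Fin 4 → N) :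
    NumRecog F e K (k + 1) N fun G env =>
      M.CodeStep enc g (w G) q q' (fun i => env (x i)) fun i => env (y i) := by
  have := M.finiteK
  have := M.finiteΓ
  exact iEx fun z => (const _).and ((read he hK hw _ _).and ((inMove he _ _ _ _).and
    (workMove he hg ((henc _).trans hg) ((henc _).trans hg) _ _ _ _ _ _ _)))

/-- The acceptance of a machine by a computation in logarithmic space, on the encodings of graphs
along an accessible numbering. -/
theorem accepts (he : Ranked F e) (hK : d + 2 < K) {w : LGraph.{u} d → List Bool}
    (hw : ∀ G ∈ F, ∃ ε : G.reachablePart.V ≃ Fin G.order, (∀ v, (ε v : ℕ) = e G v.1) ∧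
      w G = G.reachablePart.encode ε) (M : OfflineNTM) {enc : M.Γ → ℕ} {g : ℕ} (hg : g < K)
    (hg2 : 2 ≤ g) (henc : ∀ c, enc c < g) (hinj : enc.Injective) (hblank : enc M.blank = 0)
    {s : LGraph.{u} d → ℕ}
    (hs : ∀ G ∈ F, ∀ x, M.ReachableCfg (w G) x → x.workPos ≤ s G)
    (hlen : ∀ G ∈ F, (w G).length + 1 < K * G.order ^ (k + 1))
    (hpow : ∀ G ∈ F, g ^ (s G + 1) ≤ K * G.order ^ (k + 1)) :
    NumRecog F e K (k + 1) Empty fun G _ => M.Accepts (w G) := by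
  have := M.finiteK
  -- One variable initializes all four registers, since the initial code is identically zero; the
  -- blank is coded by 0 for this purpose.
  have h : NumRecog F e K (k + 1) Unit fun G env => ∃ (q : M.K) (y : Fin 4 → ℕ),
      ReflTransGen (NumStep K (k + 1) (fun q q' G (env : (Fin 4 ⊕ Fin 4) ⊕ Unit → ℕ) =>
        M.CodeStep enc g (w G) q q' (fun i => env (.inl (.inl i))) fun i => env (.inl (.inr i)))
        G env) (M.k₀, fun _ => env ()) (q, y) ∧
      (∀ i, y i < K * G.order ^ (k + 1)) ∧ q = M.ka :=
    tc he (fun _ => ()) M.k₀ (fun q q' => codeStep he hK hw M hg henc q q' _ _)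
      (ψ := fun q _ _ => q = M.ka) fun q => const _
  refine (ex he (φ := fun G m _ => m = 0 ∧ ∃ (q : M.K) (y : Fin 4 → ℕ),
      ReflTransGen (NumStep K (k + 1) (fun q q' G (env : (Fin 4 ⊕ Fin 4) ⊕ Unit → ℕ) =>
        M.CodeStep enc g (w G) q q' (fun i => env (.inl (.inl i))) fun i => env (.inl (.inr i)))
        G fun _ => m) (M.k₀, fun _ => m) (q, y) ∧
      (∀ i, y i < K * G.order ^ (k + 1)) ∧ q = M.ka)
    ((zero he none).and (h.sub fun _ => none))).congr he fun G hG env _ => ?_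
  have hB : ∀ x, M.ReachableCfg (w G) x → ∀ i, x.code enc g (s G) i < K * G.order ^ (k + 1) :=
    fun x hx => OfflineNTM.code_lt hg2 henc (hs G hG) hx (hlen G hG) (hpow G hG)
  have h0 : M.initial.code enc g (s G) = fun _ => 0 := by
    have : enc ∘ M.initial.work = fun _ => 0 := funext fun _ => hblank
    funext i
    fin_cases i
    · rfl
    · rfl
    · rfl
    · simp only [OfflineNTM.Cfg.code, this]
      exact rightCode_zero _ _
  constructor
  · rintro ⟨m, -, rfl, q, y, h1, -, rfl⟩
    have key : ∀ z, ReflTransGen (NumStep K (k + 1)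
        (fun q q' G (env : (Fin 4 ⊕ Fin 4) ⊕ Unit → ℕ) => M.CodeStep enc g (w G) q q'
          (fun i => env (.inl (.inl i))) fun i => env (.inl (.inr i))) G fun _ => 0)
        (M.k₀, fun _ => 0) z →
        ∃ x, M.ReachableCfg (w G) x ∧ x.state = z.1 ∧ x.code enc g (s G) = z.2 := by
      intro z hz
      induction hz with
      | refl => exact ⟨M.initial, .refl, rfl, h0⟩
      | tail _ h ih =>
        obtain ⟨x, hx1, hx2, hx3⟩ := ih
        have h4 := h.2
        simp only [Sum.elim_inl, Sum.elim_inr] at h4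
        rw [← hx2, ← hx3] at h4
        obtain ⟨x', hx', h5, h6⟩ := (OfflineNTM.codeStep_iff hinj henc (hs G hG) hx1).1 h4
        exact ⟨x', hx1.tail hx', h5, h6⟩
    obtain ⟨x, hx1, hx2, -⟩ := key _ h1
    exact ⟨x, hx1, hx2⟩
  · rintro ⟨x, hx, hxa⟩
    have hpos : 0 < K * G.order ^ (k + 1) := (Nat.zero_le _).trans_lt (hlen G hG)
    refine ⟨0, hpos, rfl, x.state, x.code enc g (s G), ?_, hB x hx, hxa⟩
    clear hxa
    induction hx with
    | refl =>
      rw [h0]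
      exact .refl
    | @tail x x' hx h ih =>
      refine ih.tail ⟨hB x' (ReflTransGen.tail hx h), ?_⟩
      exact (OfflineNTM.codeStep_iff hinj henc (hs G hG) hx).2 ⟨x', h, rfl, rfl⟩

end NumRecog

/-- Automata decide all properties in NLOGSPACE of the reachable part, on orderable families. -/
theorem OrderableFamily.exists_jag {d : ℕ} {F : Set (LGraph.{u} d)} (h : OrderableFamily F)
    {R : SGraph.{u} d → Prop} (hR : IsNLogspaceProperty R) :
    ∃ J : NDJag d, ∀ G ∈ F, J.Accepts G ↔ R G.reachablePart := by
  classical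
  obtain ⟨L, ⟨M, ⟨c, hc⟩, hM⟩, hL⟩ := hR
  obtain ⟨e, hbij, hsucc, hzero, hlast⟩ := h.exists_rank
  have he : Ranked F e := ⟨hbij, hsucc, hzero, hlast⟩
  have hε : ∀ G, ∃ w : List Bool, G ∈ F → ∃ ε : G.reachablePart.V ≃ Fin G.order,
      (∀ v, (ε v : ℕ) = e G v.1) ∧ w = G.reachablePart.encode ε := fun G => by
    by_cases hG : G ∈ F
    · let f : G.reachablePart.V → Fin G.order := fun v => ⟨e G v.1, he.lt_order hG v.2⟩
      have hf : f.Bijective := by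
        constructor
        · intro v v' hv
          exact Subtype.ext ((hbij G hG).injOn v.2 v'.2 (congrArg Fin.val hv))
        · intro m
          obtain ⟨v, hv1, hv2⟩ := (hbij G hG).surjOn (show (m : ℕ) ∈ Set.Iio G.order from m.2)
          exact ⟨⟨v, hv1⟩, Fin.ext hv2⟩
      exact ⟨_, fun _ => ⟨Equiv.ofBijective f hf, fun _ => rfl, rfl⟩⟩
    · exact ⟨[], fun h => absurd h hG⟩
  choose w hw using hε
  obtain ⟨g, enc, hg2, henc, hinj, hblank⟩ : ∃ (g : ℕ) (enc : M.Γ → ℕ), 2 ≤ g ∧ (∀ c, enc c < g) ∧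
      enc.Injective ∧ enc M.blank = 0 := by
    have := M.finiteΓ
    obtain ⟨n, ⟨f⟩⟩ := Finite.exists_equiv_fin M.Γ
    -- The blank gets code 0 and the other symbols positive codes at most `n`. The base `n + 2` also
    -- ensures `2 ≤ g`.
    refine ⟨n + 2, fun c => if c = M.blank then 0 else f c + 1, by omega, fun c => ?_,
      fun a b hab => ?_, by simp⟩
    · dsimp only
      split_ifs <;> omega
    · dsimp only at hab
      split_ifs at hab with h1 h2 h2
      · rw [h1, h2]
      · exact f.injective (Fin.ext (by omega))
  -- The product is the constant from `pow_log_le`. The remaining summands make `d`, `g` and the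
  -- length of the input fit below the bound. The choice of `k` below makes `k + 1` the exponent in
  -- `pow_log_le`.
  let K := g ^ (c + 1) * (d + 2) ^ (g * c) + d + g + 5
  have hlen : ∀ G ∈ F, (w G).length = (G.order * d + 2) * G.order := fun G hG => by
    obtain ⟨ε, -, h⟩ := hw G hG
    rw [h, SGraph.length_encode]
  have h0 : ∀ G ∈ F, 0 < G.order := fun G hG =>
    (Nat.zero_le _).trans_lt (he.lt_order hG G.reachable_startnode)
  have hacc := NumRecog.accepts (K := K) (k := 2 * (g * c) + 1) he (by omega) hw M (by omega) hg2
    henc hinj hblank (s := fun G => c * (Nat.log 2 ((G.order * d + 2) * G.order) + 1))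
    (fun G hG x hx => by rw [← hlen G hG]; exact hc _ _ hx)
    (fun G hG => by
      rw [hlen G hG]
      have h1 : G.order ^ 2 ≤ G.order ^ (2 * (g * c) + 1 + 1) :=
        Nat.pow_le_pow_right (h0 G hG) (by omega)
      have h2 : (d + 5) * G.order ^ (2 * (g * c) + 1 + 1) ≤
          K * G.order ^ (2 * (g * c) + 1 + 1) := Nat.mul_le_mul_right _ (by omega)
      have := h0 G hG
      nlinarith)
    (fun G hG => (pow_log_le g c d _ (h0 G hG)).trans (Nat.mul_le_mul_right _ (by omega)))
  obtain ⟨J, hJ⟩ := hacc.recog.exists_jag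
  refine ⟨J, fun G hG => (hJ G hG).trans ((hM _).trans ?_)⟩
  obtain ⟨ε, -, h⟩ := hw G hG
  rw [h]
  exact hL _ _ ε

theorem mainTheorem4 (d : ℕ) (hd : 1 < d) (F : Set (LGraph.{u} d)) :
    (TraversableFamily F →
      ∃ J : NDJag d, ∀ G ∈ F, J.Accepts G ↔ ¬ G.Reachable G.targetnode) ∧
    (OrderableFamily F →
      ∀ R : SGraph.{u} d → Prop, IsNLogspaceProperty R →
        ∃ J : NDJag d, ∀ G ∈ F, J.Accepts G ↔ R G.reachablePart) :=
  ⟨Recog.exists_jag_not_reachable, fun h _ hR => h.exists_jag hR⟩
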